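/- Let $V:\mathbb R\to\mathbb R$ be the function $$V(x)=\frac{1}{4\lambda^2}\operatorname{sech}^2\Big(\frac{x}{\lambda\sqrt2}\Big)+3\lambda\tanh\Big(\frac{x}{\lambda\sqrt2}\Big)\cosh^2\Big(\frac{x}{\lambda\sqrt2}\Big)\tanh\Big(\frac{x}{\sqrt2}\Big)\operatorname{sech}^2\Big(\frac{x}{\sqrt2}\Big),\qquad \lambda=8,$$ and let $$Y_1(x)=2^{-3/4}3^{1/2}\tanh\Big(\frac{x}{\sqrt2}\Big)\operatorname{sech}\Big(\frac{x}{\sqrt2}\Big),\qquad Z_1(x)=Y_1(x)\cosh\Big(\frac{x}{8\sqrt2}\Big).$$ For a real-valued function $w$ on $\mathbb R$ with weak derivative $w_x$ put $$\mathcal B^\sharp(w)=\int_{\mathbb R}\big(w_x^2-Vw^2\big)\,dx .$$ (a) There exists $\kappa>0$ such that, for every odd real-valued $w\in H^1(\mathbb R)$ with $\int_{\mathbb R}wZ_1\,dx=0$, $$\mathcal B^\sharp(w)\ \ge\ \kappa\int_{\mathbb R}w_x^2\,dx .$$ (b) There exists $\kappa>0$ such that the same inequality holds for every odd real-valued $w\in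 L^\infty(\mathbb R)$ with weak derivative $w_x\in L^2(\mathbb R)$ and $\int_{\mathbb R}wZ_1\,dx=0$. -/

import Mathlib

open MeasureTheory
open scoped ContDiff

noncomputable section

namespace KinkVirial

/-- Hyperbolic secant. -/
def sech (x : ℝ) : ℝ := (Real.cosh x)⁻¹

/-- The kink `H(x) = tanh (x / √2)`. -/
def kink (x : ℝ) : ℝ := Real.tanh (x / √2)

/-- The virial weight `ψ(x) = λ √2 H(x / λ)`, where `lam` is the scale `λ`. -/
def psi (lam x : ℝ) : ℝ := lam * √2 * kink (x / lam)

/-- `ζ = √ψ'`. -/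
def zeta (lam x : ℝ) : ℝ := √(deriv (psi lam) x)

/-- The potential
`V = (1/(4λ²)) sech²(x/(λ√2)) + 3λ tanh(x/(λ√2)) cosh²(x/(λ√2)) tanh(x/√2) sech²(x/√2)`. -/
def V (lam x : ℝ) : ℝ :=
  1 / (4 * lam ^ 2) * sech (x / (lam * √2)) ^ 2
    + 3 * lam * Real.tanh (x / (lam * √2)) * Real.cosh (x / (lam * √2)) ^ 2
      * Real.tanh (x / √2) * sech (x / √2) ^ 2

/-- The internal mode `Y₁ = 2^(-3/4) 3^(1/2) tanh(x/√2) sech(x/√2)`. -/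
def Y₁ (x : ℝ) : ℝ :=
  (2 : ℝ) ^ (-(3 / 4) : ℝ) * (3 : ℝ) ^ (1 / 2 : ℝ) * Real.tanh (x / √2) * sech (x / √2)

/-- `Z₁ = Y₁ cosh(x/(λ√2))`. -/
def Z₁ (lam x : ℝ) : ℝ := Y₁ x * Real.cosh (x / (lam * √2))

/-- `w'` is a weak (distributional) derivative of `w` on the real line. -/
structure IsWeakDeriv (w w' : ℝ → ℝ) : Prop where
  locallyIntegrable : LocallyIntegrable w
  locallyIntegrable_deriv : LocallyIntegrable w'
  integral_mul_deriv : ∀ φ : ℝ → ℝ, ContDiff ℝ ∞ φ → HasCompactSupport φ →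
    ∫ x, w x * deriv φ x = -∫ x, w' x * φ x

/-- Oddness of a function that is defined up to almost everywhere equality. -/
def IsOddAE (w : ℝ → ℝ) : Prop := ∀ᵐ x : ℝ, w (-x) = -w x

/-- The virial quadratic form `∫ (w_x² - V w²)` of a function `w` with weak derivative `w'`. -/
def virialForm (lam : ℝ) (w w' : ℝ → ℝ) : ℝ := ∫ x, (w' x ^ 2 - V lam x * w x ^ 2)

theorem hasDerivAt_tanh_div (c x : ℝ) :
    HasDerivAt (fun y => Real.tanh (y / c)) (sech (x / c) ^ 2 / c) x := by
  have h0 : HasDerivAt (fun y : ℝ => y / c) (1 / c) x := (hasDerivAt_id x).div_const c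
  have h1 := (h0.sinh).div (h0.cosh) (Real.cosh_pos _).ne'
  have h2 : (fun y : ℝ => Real.tanh (y / c))
      = (fun y => Real.sinh (y / c)) / fun y => Real.cosh (y / c) := by
    funext y; simp [Real.tanh_eq_sinh_div_cosh]
  rw [h2]
  refine h1.congr_deriv ?_
  have hc := (Real.cosh_pos (x / c)).ne'
  have hs := Real.cosh_sq (x / c)
  simp only [sech]
  field_simp
  linear_combination hs / c

theorem deriv_psi {lam : ℝ} (h : 0 < lam) (x : ℝ) :
    deriv (psi lam) x = sech (x / (lam * √2)) ^ 2 := by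
  have h2 : (√2 : ℝ) ≠ 0 := by positivity
  have e : psi lam = fun y => lam * √2 * Real.tanh (y / (lam * √2)) := by
    funext y; simp [psi, kink, div_div]
  rw [e, ((hasDerivAt_tanh_div (lam * √2) x).const_mul (lam * √2)).deriv]
  field_simp

theorem zeta_eq {lam : ℝ} (h : 0 < lam) :
    zeta lam = fun x => sech (x / (lam * √2)) := by
  funext x
  rw [zeta, deriv_psi h, Real.sqrt_sq]
  exact inv_nonneg.mpr (Real.cosh_pos _).le

theorem deriv_kink (x : ℝ) : deriv kink x = sech (x / √2) ^ 2 / √2 :=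
  (hasDerivAt_tanh_div √2 x).deriv

theorem hasDerivAt_sech_div (c x : ℝ) :
    HasDerivAt (fun y => sech (y / c)) (-(Real.tanh (x / c) * sech (x / c)) / c) x := by
  have h0 : HasDerivAt (fun y : ℝ => y / c) (1 / c) x := (hasDerivAt_id x).div_const c
  have h1 := (h0.cosh).fun_inv (Real.cosh_pos _).ne'
  unfold sech
  refine h1.congr_deriv ?_
  have hc := (Real.cosh_pos (x / c)).ne'
  rw [Real.tanh_eq_sinh_div_cosh]
  field_simp

/-- The explicit potential is the one produced by the virial identity,
`V = -(1/2) (ζ''/ζ - (ζ')²/ζ²) + 3 (ψ/ψ') H H'`. -/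
theorem V_eq {lam : ℝ} (h : 0 < lam) (x : ℝ) :
    V lam x = -(1 / 2) * (deriv (deriv (zeta lam)) x / zeta lam x
        - deriv (zeta lam) x ^ 2 / zeta lam x ^ 2)
      + 3 * (psi lam x / deriv (psi lam) x) * kink x * deriv kink x := by
  have h2 : (√2 : ℝ) ≠ 0 := by positivity
  have hq : (√2 : ℝ) ^ 2 = 2 := Real.sq_sqrt (by norm_num)
  set c := lam * √2 with hc
  have d1 : deriv (zeta lam) = fun y => -(Real.tanh (y / c) * sech (y / c)) / c := by
    rw [zeta_eq h]; funext y; exact (hasDerivAt_sech_div c y).deriv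
  have d2 : deriv (deriv (zeta lam)) x
      = -(sech (x / c) ^ 2 / c * sech (x / c)
          + Real.tanh (x / c) * (-(Real.tanh (x / c) * sech (x / c)) / c)) / c := by
    rw [d1]
    exact (((hasDerivAt_tanh_div c x).fun_mul (hasDerivAt_sech_div c x)).fun_neg.div_const c).deriv
  rw [d2, d1, deriv_psi h, deriv_kink, zeta_eq h, V]
  simp only [psi, kink, div_div, ← hc]
  have hs : sech (x / c) ≠ 0 := inv_ne_zero (Real.cosh_pos _).ne'
  have hcosh : Real.cosh (x / c) = (sech (x / c))⁻¹ := by simp [sech]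
  rw [hcosh, hc]
  field_simp
  rw [hq]
  ring

end KinkVirial

end

namespace KinkVirial

open Set Filter Topology

/-! After the substitution `x = √2 y` the potential becomes `q = scaledPotential` (up to a factor 2)
and the mode becomes a multiple of `Z = scaledMode`. An odd `w` is a.e. the primitive `W` of its
weak derivative `u` that vanishes at 0. By symmetry it suffices to show `∫ (u² - Q W²) ≥ 0` on the
half line, with `Q = (101/100) q` and `∫ W Z = 0`. The spare factor 101/100 gives the coercivity
constant `1 - 100/101 = 1/101` in both parts.

The half-line inequality is a Jacobi-type argument adapted to a constraint. Without one, a positive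
`g` with `g'' + Q g ≤ 0` would give `u² - Q W² ≥ (g'/g · W²)'`. Here only `g'' + Q g ≤ c Z` is
available. Put `v(x) = ∫₀ˣ W Z`, so that `v' = W Z`, and subtract from `u² - Q W²` the derivative of
the null Lagrangian `g'/g · W² - 2c W v / g - c σ v²`. What remains is a sum of squares with
nonnegative weights as soon as `σ' ≥ σ² g Z + c / g²` (`Certificate.pointwise`). The boundary terms
vanish at 0 because `W` and `v` are small there, and at infinity because orthogonality forces `v` to
decay exponentially (`Certificate.tendsto_boundary_zero`, `Certificate.tendsto_boundary_atTop`).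

The concrete certificate is `g = 2 tanh x + 3 tanh³ x + 4 tanh (x/8)` with `c = 15`, and `σ` is a
rational function of `cosh (x/2)` and `sinh (x/2)`. Both differential inequalities become algebraic
in `cosh (x/8)` and its double angles (`AngleData`). Rational bounds in `d = cosh (x/2)` then reduce
them to polynomial inequalities in `u = d - 1 ≥ 0`. -/

/-! ### Weak derivatives and primitives on the line -/

theorem exists_support_subset_Ioo {φ : ℝ → ℝ} (hφ : HasCompactSupport φ) :
    ∃ R : ℝ, 0 < R ∧ ∀ x, x ∉ Ioo (-R) R → φ x = 0 := by
  obtain ⟨R, hR⟩ := hφ.isCompact.isBounded.subset_ball (0 : ℝ)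
  refine ⟨max R 1, by positivity, fun x hx => ?_⟩
  by_contra h
  have h1 : x ∈ Metric.ball (0 : ℝ) R := hR (subset_tsupport _ h)
  rw [Real.ball_eq_Ioo] at h1
  exact hx ⟨by linarith [h1.1, le_max_left R 1], by linarith [h1.2, le_max_left R 1]⟩

theorem integral_eq_intervalIntegral_of_support {f : ℝ → ℝ} {R : ℝ} (hR : 0 < R)
    (hf : ∀ x, x ∉ Ioo (-R) R → f x = 0) : ∫ x, f x = ∫ x in (-R)..R, f x := by
  rw [intervalIntegral.integral_of_le (by linarith), setIntegral_eq_integral_of_forall_compl_eq_zero]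
  intro x hx
  exact hf x fun h => hx ⟨h.1, h.2.le⟩

/-- Widening the interval by 1 gives every outside point a neighbourhood on which `φ` vanishes, so
no regularity at `±R` is needed. -/
theorem deriv_eq_zero_of_support {φ : ℝ → ℝ} {R : ℝ}
    (hf : ∀ x, x ∉ Ioo (-R) R → φ x = 0) :
    ∀ x, x ∉ Ioo (-(R + 1)) (R + 1) → deriv φ x = 0 := by
  intro x hx
  have h : φ =ᶠ[𝓝 x] fun _ => 0 := by
    have : (Icc (-R) R)ᶜ ∈ 𝓝 x := by
      refine isClosed_Icc.isOpen_compl.mem_nhds fun h => hx ⟨?_, ?_⟩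
      · linarith [h.1]
      · linarith [h.2]
    filter_upwards [this] with y hy
    exact hf y fun h => hy ⟨h.1.le, h.2.le⟩
  rw [h.deriv_eq]; simp

/-- Integration by parts for absolutely continuous functions; the primitive has derivative `u` a.e.
by Lebesgue differentiation. -/
theorem integral_primitive_mul_deriv {u : ℝ → ℝ} (hu : LocallyIntegrable u) {φ : ℝ → ℝ}
    (hφ : ContDiff ℝ ∞ φ) (hc : HasCompactSupport φ) :
    ∫ x, (∫ t in (0 : ℝ)..x, u t) * deriv φ x = -∫ x, u x * φ x := by
  obtain ⟨R, hR, hs⟩ := exists_support_subset_Ioo hc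
  have hs' : ∀ x, x ∉ Ioo (-(R + 1)) (R + 1) → φ x = 0 := fun x hx =>
    hs x fun h => hx ⟨by linarith [h.1], by linarith [h.2]⟩
  have hd := deriv_eq_zero_of_support hs
  rw [integral_eq_intervalIntegral_of_support (R := R + 1) (by linarith)
      (fun x hx => by rw [hd x hx, mul_zero]),
    integral_eq_intervalIntegral_of_support (R := R + 1) (by linarith)
      (fun x hx => by rw [hs' x hx, mul_zero])]
  have hi : IntervalIntegrable u volume (-(R + 1)) (R + 1) :=
    (hu.integrableOn_isCompact isCompact_uIcc).intervalIntegrable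
  have hW := hi.absolutelyContinuousOnInterval_intervalIntegral (c := 0)
    (by rw [uIcc_of_le (by linarith)]; exact ⟨by linarith, by linarith⟩)
  have hφ' : AbsolutelyContinuousOnInterval φ (-(R + 1)) (R + 1) :=
    (hφ.of_le (by simp)).contDiffOn.absolutelyContinuousOnInterval
  rw [hW.integral_mul_deriv_eq_deriv_mul hφ', hs' (R + 1) (by simp), hs' (-(R + 1)) (by simp)]
  simp only [mul_zero, sub_zero, zero_sub, neg_inj]
  refine intervalIntegral.integral_congr_ae ?_
  filter_upwards [_root_.LocallyIntegrable.ae_hasDerivAt_integral hu] with x hx _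
  rw [(hx 0).deriv]

/-- A locally integrable function whose distributional derivative vanishes is constant. -/
theorem ae_eq_const_of_integral_mul_deriv_eq_zero {f : ℝ → ℝ} (hf : LocallyIntegrable f)
    (h : ∀ φ : ℝ → ℝ, ContDiff ℝ ∞ φ → HasCompactSupport φ → ∫ x, f x * deriv φ x = 0) :
    ∃ c : ℝ, ∀ᵐ x, f x = c := by
  let b : ContDiffBump (0 : ℝ) := ⟨1, 2, by norm_num, by norm_num⟩
  set φ₀ : ℝ → ℝ := b.normed volume with hφ₀
  have h₀ : ContDiff ℝ ∞ φ₀ := b.contDiff_normed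
  have h₀c : HasCompactSupport φ₀ := b.hasCompactSupport_normed
  have h₀i : ∫ x, φ₀ x = 1 := b.integral_normed
  refine ⟨∫ x, f x * φ₀ x, ?_⟩
  set c := ∫ x, f x * φ₀ x with hcdef
  have key := ae_eq_zero_of_integral_contDiff_smul_eq_zero (μ := volume)
    (f := fun x => f x - c) (hf.sub (locallyIntegrable_const c)) ?_
  · filter_upwards [key] with x hx
    linarith
  intro φ hφ hφc
  have hcont := hφ.continuous
  have hφi : Integrable φ := hcont.integrable_of_hasCompactSupport hφc
  have h₀int : Integrable φ₀ := h₀.continuous.integrable_of_hasCompactSupport h₀c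
  set m := ∫ x, φ x with hm
  -- Subtracting `m φ₀` removes the mean, so the primitive `ψ` of `η` has compact support and is an
  -- admissible test function. Testing with it gives `∫ f η = 0`, which is `∫ (f - c) φ = 0`.
  set η : ℝ → ℝ := fun x => φ x - m * φ₀ x with hη
  have hηd : ContDiff ℝ ∞ η := hφ.sub (contDiff_const.mul h₀)
  have hηc : HasCompactSupport η := hφc.sub (h₀c.mul_left)
  have hηi : ∫ x, η x = 0 := by
    rw [hη, integral_sub hφi (h₀int.const_mul m), integral_const_mul, h₀i, mul_one, ← hm, sub_self]
  obtain ⟨R, hR, hs⟩ := exists_support_subset_Ioo hηc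
  set ψ : ℝ → ℝ := fun x => ∫ t in (-R)..x, η t with hψ
  have hψ' : ∀ x, HasDerivAt ψ (η x) x := fun x =>
    hηd.continuous.integral_hasStrictDerivAt (-R) x |>.hasDerivAt
  have hψd : deriv ψ = η := funext fun x => (hψ' x).deriv
  have hψs : ContDiff ℝ ∞ ψ := by
    rw [contDiff_infty_iff_deriv]
    exact ⟨fun x => (hψ' x).differentiableAt, hψd ▸ hηd⟩
  have hψc : HasCompactSupport ψ := by
    refine HasCompactSupport.intro (isCompact_Icc (a := -R) (b := R)) fun x hx => ?_
    rcases lt_or_ge x (-R) with h1 | h1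
    · refine intervalIntegral.integral_zero_ae (Eventually.of_forall fun t ht => hs t fun h2 => ?_)
      rw [uIoc_of_ge h1.le] at ht
      linarith [ht.2, h2.1]
    · have h2 : R < x := by
        by_contra h3
        exact hx ⟨h1, not_lt.mp h3⟩
      have e : ψ x = (∫ t in (-R)..R, η t) + ∫ t in R..x, η t :=
        (intervalIntegral.integral_add_adjacent_intervals
          (hηd.continuous.intervalIntegrable _ _) (hηd.continuous.intervalIntegrable _ _)).symm
      rw [e, ← integral_eq_intervalIntegral_of_support hR hs, hηi, zero_add]
      refine intervalIntegral.integral_zero_ae (Eventually.of_forall fun t ht => hs t fun h3 => ?_)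
      rw [uIoc_of_le h2.le] at ht
      linarith [ht.1, h3.2]
  have h1 := h ψ hψs hψc
  rw [hψd] at h1
  have i1 : Integrable fun x => f x * φ x := by
    simpa [mul_comm, smul_eq_mul] using hf.integrable_smul_left_of_hasCompactSupport hcont hφc
  have i2 : Integrable fun x => f x * φ₀ x := by
    simpa [mul_comm, smul_eq_mul] using
      hf.integrable_smul_left_of_hasCompactSupport h₀.continuous h₀c
  have h2 : ∫ x, f x * η x = (∫ x, f x * φ x) - m * c := by
    rw [hcdef, ← integral_const_mul, ← integral_sub i1 (i2.const_mul m)]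
    refine integral_congr_ae (Eventually.of_forall fun x => ?_)
    simp only [hη]; ring
  have h3 : ∫ x, φ x • (f x - c) = (∫ x, f x * φ x) - m * c := by
    rw [hm, mul_comm, ← integral_const_mul, ← integral_sub i1 (hφi.const_mul c)]
    refine integral_congr_ae (Eventually.of_forall fun x => ?_)
    simp only [smul_eq_mul]; ring
  rw [h3, ← h2, h1]

theorem continuous_primitive_of_locallyIntegrable {u : ℝ → ℝ} (hu : LocallyIntegrable u) :
    Continuous fun x => ∫ t in (0 : ℝ)..x, u t :=
  intervalIntegral.continuous_primitive
    (fun _ _ => (hu.integrableOn_isCompact isCompact_uIcc).intervalIntegrable) 0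

/-- A function with a weak derivative is almost everywhere a primitive of it. -/
theorem IsWeakDeriv.exists_ae_eq_primitive {w w' : ℝ → ℝ} (h : IsWeakDeriv w w') :
    ∃ c : ℝ, ∀ᵐ x, w x = c + ∫ t in (0 : ℝ)..x, w' t := by
  have hW := continuous_primitive_of_locallyIntegrable h.locallyIntegrable_deriv
  obtain ⟨c, hc⟩ := ae_eq_const_of_integral_mul_deriv_eq_zero
    (f := fun x => w x - ∫ t in (0 : ℝ)..x, w' t)
    (h.locallyIntegrable.sub hW.locallyIntegrable) (by
      intro φ hφ hφc
      have hd : Continuous (deriv φ) := hφ.continuous_deriv (by simp)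
      have i1 : Integrable fun x => w x * deriv φ x := by
        simpa [mul_comm, smul_eq_mul] using
          h.locallyIntegrable.integrable_smul_left_of_hasCompactSupport hd hφc.deriv
      have i2 : Integrable fun x => (∫ t in (0 : ℝ)..x, w' t) * deriv φ x :=
        (hW.mul hd).integrable_of_hasCompactSupport hφc.deriv.mul_left
      simp only [sub_mul]
      rw [integral_sub i1 i2, h.integral_mul_deriv φ hφ hφc,
        integral_primitive_mul_deriv h.locallyIntegrable_deriv hφ hφc, sub_self])
  exact ⟨c, by filter_upwards [hc] with x hx; linarith⟩

/-- An odd function with a weak derivative is almost everywhere the primitive vanishing at `0`, and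
this primitive is odd. -/
theorem IsWeakDeriv.ae_eq_primitive_of_isOddAE {w w' : ℝ → ℝ} (h : IsWeakDeriv w w')
    (ho : IsOddAE w) :
    (∀ᵐ x, w x = ∫ t in (0 : ℝ)..x, w' t) ∧
      ∀ x : ℝ, ∫ t in (0 : ℝ)..(-x), w' t = -∫ t in (0 : ℝ)..x, w' t := by
  obtain ⟨c, hc⟩ := h.exists_ae_eq_primitive
  have hW := continuous_primitive_of_locallyIntegrable h.locallyIntegrable_deriv
  set W : ℝ → ℝ := fun x => ∫ t in (0 : ℝ)..x, w' t with hWdef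
  have hc' : ∀ᵐ x : ℝ, w (-x) = c + W (-x) :=
    (Measure.measurePreserving_neg (volume : Measure ℝ)).quasiMeasurePreserving.ae hc
  -- Both sides are continuous, so the a.e. identity holds everywhere; at 0 it reads `c = -c`.
  have e : (fun x => c + W (-x)) = fun x => -(c + W x) := by
    refine (Continuous.ae_eq_iff_eq volume (by fun_prop) (by fun_prop)).mp ?_
    filter_upwards [hc, hc', ho] with x h1 h2 h3
    rw [← h2, h3, h1]
  have h0 : W 0 = 0 := by simp [hWdef]
  have c0 : c = 0 := by
    have := congrFun e 0
    simp only [neg_zero, h0] at this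
    linarith
  refine ⟨by filter_upwards [hc] with x hx; rw [hx, c0, zero_add], fun x => ?_⟩
  have := congrFun e x
  simp only [c0, zero_add] at this
  exact this

/-- Data certifying that `∫ (u² - Q W²) ≥ 0` on the half line for `W = ∫ u` orthogonal to `Z`: a
positive function `g` with `g'' + Q g ≤ c Z` and a solution `σ` of a Riccati inequality, together
with bounds at `0` and at infinity. -/
structure Certificate (g g₁ g₂ σ σ₁ Q Z : ℝ → ℝ) (c A β : ℝ) : Prop where
  A_nonneg : 0 ≤ A
  β_pos : 0 < β
  c_nonneg : 0 ≤ c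
  g_pos : ∀ x, 0 < x → 0 < g x
  Z_pos : ∀ x, 0 < x → 0 < Z x
  hasDerivAt_g : ∀ x, 0 < x → HasDerivAt g (g₁ x) x
  hasDerivAt_g₁ : ∀ x, 0 < x → HasDerivAt g₁ (g₂ x) x
  hasDerivAt_σ : ∀ x, 0 < x → HasDerivAt σ (σ₁ x) x
  continuousOn_g₂ : ContinuousOn g₂ (Ioi 0)
  continuousOn_σ₁ : ContinuousOn σ₁ (Ioi 0)
  continuous_Q : Continuous Q
  continuous_Z : Continuous Z
  supersolution : ∀ x, 0 < x → g₂ x + Q x * g x ≤ c * Z x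
  riccati : ∀ x, 0 < x → σ x ^ 2 * (g x * Z x) + c / g x ^ 2 ≤ σ₁ x
  -- The rates below are matched to the boundary terms: near 0, `W² = O(x ∫₀ˣ u²)` and `v² = O(x⁵
  -- ∫₀ˣ u²)`; at infinity `W` grows at most like `√x` and `v` decays like `exp (-3βx)`.
  near_logDeriv : ∀ x, 0 < x → x ≤ 1 → |g₁ x / g x| ≤ A / x
  near_inv : ∀ x, 0 < x → x ≤ 1 → 1 / g x ≤ A / x
  near_σ : ∀ x, 0 < x → x ≤ 1 → |σ x| ≤ A / x ^ 3
  near_Z : ∀ x, 0 < x → x ≤ 1 → Z x ≤ A * x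
  far_logDeriv : ∀ x, 1 ≤ x → |g₁ x / g x| ≤ A * Real.exp (-β * x)
  far_inv : ∀ x, 1 ≤ x → 1 / g x ≤ A
  far_σ : ∀ x, 1 ≤ x → |σ x| ≤ A * Real.exp (4 * β * x)
  far_Z : ∀ x, 0 < x → Z x ≤ A * Real.exp (-(4 * β) * x)
  far_Q : ∀ x, 0 < x → |Q x| ≤ A * Real.exp (-β * x)

/-! ### Growth of primitives of square-integrable functions -/

section Primitive

variable {u : ℝ → ℝ}

theorem intervalIntegrable_of_memLp (hu : MemLp u 2 volume) (a b : ℝ) :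
    IntervalIntegrable u volume a b :=
  ((hu.locallyIntegrable (by norm_num)).integrableOn_isCompact isCompact_uIcc).intervalIntegrable

theorem sq_primitive_le (hu : MemLp u 2 volume) {x : ℝ} (hx : 0 < x) :
    (∫ t in (0 : ℝ)..x, u t) ^ 2 ≤ x * ∫ t in (0 : ℝ)..x, u t ^ 2 := by
  have i1 := intervalIntegrable_of_memLp hu 0 x
  have i2 : IntervalIntegrable (fun t => u t ^ 2) volume 0 x := hu.integrable_sq.intervalIntegrable
  -- With `m` the mean of `u`, Cauchy–Schwarz is the nonnegativity of the variance.
  set m := (∫ t in (0 : ℝ)..x, u t) / x with hm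
  have h : 0 ≤ ∫ t in (0 : ℝ)..x, (u t - m) ^ 2 :=
    intervalIntegral.integral_nonneg hx.le fun t _ => sq_nonneg _
  have e : ∫ t in (0 : ℝ)..x, (u t - m) ^ 2
      = (∫ t in (0 : ℝ)..x, u t ^ 2) - 2 * m * (∫ t in (0 : ℝ)..x, u t) + x * m ^ 2 := by
    have : ∀ t, (u t - m) ^ 2 = u t ^ 2 - 2 * m * u t + m ^ 2 := fun t => by ring
    simp only [this]
    rw [intervalIntegral.integral_add (i2.sub (i1.const_mul _)) (by simp),
      intervalIntegral.integral_sub i2 (i1.const_mul _), intervalIntegral.integral_const_mul]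
    simp
  have e2 : ∫ t in (0 : ℝ)..x, u t = m * x := by rw [hm]; field_simp
  rw [e, e2] at h
  rw [e2]
  nlinarith

theorem integral_sq_mono (hu : MemLp u 2 volume) {x y : ℝ} (hx : 0 ≤ x) (hxy : x ≤ y) :
    ∫ t in (0 : ℝ)..x, u t ^ 2 ≤ ∫ t in (0 : ℝ)..y, u t ^ 2 :=
  intervalIntegral.integral_mono_interval le_rfl hx hxy
    (Eventually.of_forall fun t => sq_nonneg (u t)) hu.integrable_sq.intervalIntegrable

theorem integral_sq_le (hu : MemLp u 2 volume) {x : ℝ} (hx : 0 ≤ x) :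
    ∫ t in (0 : ℝ)..x, u t ^ 2 ≤ ∫ t, u t ^ 2 := by
  rw [intervalIntegral.integral_of_le hx]
  exact setIntegral_le_integral hu.integrable_sq (Eventually.of_forall fun t => sq_nonneg (u t))

theorem abs_primitive_le (hu : MemLp u 2 volume) {x : ℝ} (hx : 0 < x) :
    |∫ t in (0 : ℝ)..x, u t| ≤ √(x * ∫ t in (0 : ℝ)..x, u t ^ 2) :=
  Real.abs_le_sqrt (sq_primitive_le hu hx)

theorem sq_primitive_le_mul_integral (hu : MemLp u 2 volume) {x : ℝ} (hx : 0 < x) :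
    (∫ t in (0 : ℝ)..x, u t) ^ 2 ≤ x * ∫ t, u t ^ 2 :=
  (sq_primitive_le hu hx).trans (mul_le_mul_of_nonneg_left (integral_sq_le hu hx.le) hx.le)

/-- The true growth is `√x`; a bound with an arbitrarily small exponential rate combines more easily
with the exponential decay of `Z`, `Q` and `g'/g`. -/
theorem abs_primitive_le_exp (hu : MemLp u 2 volume) {x β : ℝ} (hx : 0 < x) (hβ : 0 < β) :
    |∫ t in (0 : ℝ)..x, u t| ≤ √(∫ t, u t ^ 2) * (1 + 1 / β) * Real.exp (β * x) := by
  have h1 : |∫ t in (0 : ℝ)..x, u t| ≤ √(x * ∫ t, u t ^ 2) :=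
    Real.abs_le_sqrt (sq_primitive_le_mul_integral hu hx)
  have h2 : √(x * ∫ t, u t ^ 2) = √(∫ t, u t ^ 2) * √x := by rw [Real.sqrt_mul hx.le, mul_comm]
  have h3 : √x ≤ 1 + x := by
    rw [Real.sqrt_le_left (by linarith)]; nlinarith
  have h4 := Real.add_one_le_exp (β * x)
  have h5 : x ≤ 1 / β * Real.exp (β * x) := by
    rw [div_mul_eq_mul_div, le_div_iff₀ hβ]; linarith
  have h6 : 1 ≤ Real.exp (β * x) := Real.one_le_exp (by positivity)
  rw [h2] at h1
  refine h1.trans ?_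
  rw [mul_assoc]
  refine mul_le_mul_of_nonneg_left ?_ (Real.sqrt_nonneg _)
  linarith

end Primitive

/-! ### A certificate makes the half-line form nonnegative -/

namespace Certificate

variable {g g₁ g₂ σ σ₁ Q Z u : ℝ → ℝ} {c A β : ℝ}

/-- Here `p`, `w`, `v` stand for `u`, `W` and `∫ W Z`, and the subtracted terms are the derivative
of the null Lagrangian. Completing the square in `p` and then in `w` leaves four terms, whose
weights are nonnegative by the supersolution and Riccati inequalities. -/
theorem pointwise (C : Certificate g g₁ g₂ σ σ₁ Q Z c A β) {x : ℝ} (hx : 0 < x) (p w v : ℝ) :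
    ((g₂ x * g x - g₁ x * g₁ x) / g x ^ 2 * w ^ 2 + g₁ x / g x * (2 * w * p))
      - 2 * c * ((p * v + w * (w * Z x)) / g x - w * v * g₁ x / g x ^ 2)
      - c * (σ₁ x * v ^ 2 + σ x * (2 * v * (w * Z x))) ≤ p ^ 2 - Q x * w ^ 2 := by
  have hg := C.g_pos x hx
  have hZ := C.Z_pos x hx
  have h1 := C.supersolution x hx
  have h2 := C.riccati x hx
  have hc := C.c_nonneg
  have e : p ^ 2 - Q x * w ^ 2 - (((g₂ x * g x - g₁ x * g₁ x) / g x ^ 2 * w ^ 2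
      + g₁ x / g x * (2 * w * p))
      - 2 * c * ((p * v + w * (w * Z x)) / g x - w * v * g₁ x / g x ^ 2)
      - c * (σ₁ x * v ^ 2 + σ x * (2 * v * (w * Z x))))
      = (p - g₁ x / g x * w + c * v / g x) ^ 2
        + (c * Z x - (g₂ x + Q x * g x)) / g x * w ^ 2
        + c * (Z x / g x * (w + σ x * g x * v) ^ 2)
        + c * (σ₁ x - (σ x ^ 2 * (g x * Z x) + c / g x ^ 2)) * v ^ 2 := by
    field_simp
    ring
  have : 0 ≤ (p - g₁ x / g x * w + c * v / g x) ^ 2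
        + (c * Z x - (g₂ x + Q x * g x)) / g x * w ^ 2
        + c * (Z x / g x * (w + σ x * g x * v) ^ 2)
        + c * (σ₁ x - (σ x ^ 2 * (g x * Z x) + c / g x ^ 2)) * v ^ 2 := by
    have a1 : 0 ≤ c * Z x - (g₂ x + Q x * g x) := by linarith
    have a2 : 0 ≤ σ₁ x - (σ x ^ 2 * (g x * Z x) + c / g x ^ 2) := by linarith
    positivity
  linarith

/-- The null Lagrangian whose derivative is dominated by the quadratic form. -/
noncomputable def boundary (g g₁ σ Z u : ℝ → ℝ) (c : ℝ) (x : ℝ) : ℝ :=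
  g₁ x / g x * (∫ t in (0 : ℝ)..x, u t) ^ 2
    - 2 * c * ((∫ t in (0 : ℝ)..x, u t)
      * (∫ t in (0 : ℝ)..x, (∫ s in (0 : ℝ)..t, u s) * Z t) / g x)
    - c * (σ x * (∫ t in (0 : ℝ)..x, (∫ s in (0 : ℝ)..t, u s) * Z t) ^ 2)

theorem absolutelyContinuousOnInterval_of_hasDerivAt {f f' : ℝ → ℝ} {a b : ℝ} (ha : 0 < a) (hab : a ≤ b)
    (h : ∀ x, 0 < x → HasDerivAt f (f' x) x) (hc : ContinuousOn f' (Ioi 0)) :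
    AbsolutelyContinuousOnInterval f a b := by
  refine ContDiffOn.absolutelyContinuousOnInterval ?_
  have hs : uIcc a b ⊆ Ioi 0 := by
    rw [uIcc_of_le hab]; exact fun x hx => lt_of_lt_of_le ha hx.1
  refine ContDiffOn.mono ?_ hs
  rw [show (1 : WithTop ℕ∞) = 0 + 1 by simp, contDiffOn_succ_iff_deriv_of_isOpen isOpen_Ioi]
  refine ⟨fun x hx => (h x hx).differentiableAt.differentiableWithinAt, by simp, ?_⟩
  rw [contDiffOn_zero]
  exact hc.congr fun x hx => (h x hx).deriv

theorem continuous_primitive (hu : MemLp u 2 volume) :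
    Continuous fun x => ∫ t in (0 : ℝ)..x, u t :=
  continuous_primitive_of_locallyIntegrable (hu.locallyIntegrable (by norm_num))

/-- Since `u` is only square integrable, `boundary` is absolutely continuous rather than
differentiable; away from 0 the a.e. pointwise inequality can still be integrated. -/
theorem boundary_sub_le (C : Certificate g g₁ g₂ σ σ₁ Q Z c A β) (hu : MemLp u 2 volume)
    {a b : ℝ} (ha : 0 < a) (hab : a ≤ b) :
    boundary g g₁ σ Z u c b - boundary g g₁ σ Z u c a
      ≤ ∫ x in a..b, (u x ^ 2 - Q x * (∫ t in (0 : ℝ)..x, u t) ^ 2) := by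
  have hW := continuous_primitive hu
  have hWZ : Continuous fun x => (∫ t in (0 : ℝ)..x, u t) * Z x := hW.mul C.continuous_Z
  have acW : AbsolutelyContinuousOnInterval (fun x => ∫ t in (0 : ℝ)..x, u t) a b :=
    ((intervalIntegrable_of_memLp hu 0 b).absolutelyContinuousOnInterval_intervalIntegral
      (c := 0) left_mem_uIcc).mono (by
        rw [uIcc_of_le hab, uIcc_of_le (by linarith)]; exact Icc_subset_Icc_left ha.le)
  have acV : AbsolutelyContinuousOnInterval
      (fun x => ∫ t in (0 : ℝ)..x, (∫ s in (0 : ℝ)..t, u s) * Z t) a b :=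
    absolutelyContinuousOnInterval_of_hasDerivAt ha hab
      (fun x _ => (hWZ.integral_hasStrictDerivAt 0 x).hasDerivAt) hWZ.continuousOn
  have cg : ContinuousOn g (Ioi 0) := fun x hx => (C.hasDerivAt_g x hx).continuousAt.continuousWithinAt
  have cg₁ : ContinuousOn g₁ (Ioi 0) :=
    fun x hx => (C.hasDerivAt_g₁ x hx).continuousAt.continuousWithinAt
  have acL : AbsolutelyContinuousOnInterval (fun x => g₁ x / g x) a b :=
    absolutelyContinuousOnInterval_of_hasDerivAt ha hab
      (fun x hx => (C.hasDerivAt_g₁ x hx).fun_div (C.hasDerivAt_g x hx) (C.g_pos x hx).ne')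
      (((C.continuousOn_g₂.mul cg).sub (cg₁.mul cg₁)).div (cg.pow 2)
        fun x hx => (pow_pos (C.g_pos x hx) 2).ne')
  have acI : AbsolutelyContinuousOnInterval (fun x => (g x)⁻¹) a b :=
    absolutelyContinuousOnInterval_of_hasDerivAt ha hab
      (fun x hx => (C.hasDerivAt_g x hx).fun_inv (C.g_pos x hx).ne')
      (cg₁.neg.div (cg.pow 2) fun x hx => (pow_pos (C.g_pos x hx) 2).ne')
  have acσ : AbsolutelyContinuousOnInterval σ a b :=
    absolutelyContinuousOnInterval_of_hasDerivAt ha hab C.hasDerivAt_σ C.continuousOn_σ₁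
  have acF : AbsolutelyContinuousOnInterval (boundary g g₁ σ Z u c) a b := by
    have := ((acL.fun_mul (acW.fun_mul acW)).fun_sub
      (((acW.fun_mul acV).fun_mul acI).const_mul (2 * c))).fun_sub
      ((acσ.fun_mul (acV.fun_mul acV)).const_mul c)
    refine (congrArg (AbsolutelyContinuousOnInterval · a b) (funext fun x => ?_)).mpr this
    simp only [boundary, sq, div_eq_mul_inv]
  rw [← acF.integral_deriv_eq_sub]
  refine intervalIntegral.integral_mono_ae_restrict hab acF.intervalIntegrable_deriv ?_ ?_
  · exact hu.integrable_sq.intervalIntegrable.sub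
      ((C.continuous_Q.mul (hW.pow 2)).intervalIntegrable _ _)
  · refine (ae_restrict_iff' measurableSet_Icc).mpr ?_
    filter_upwards [_root_.LocallyIntegrable.ae_hasDerivAt_integral
      (hu.locallyIntegrable (by norm_num))] with x hx hxab
    have hx0 : 0 < x := lt_of_lt_of_le ha hxab.1
    have d1 := hx 0
    have d2 := (hWZ.integral_hasStrictDerivAt 0 x).hasDerivAt
    have dL := (C.hasDerivAt_g₁ x hx0).fun_div (C.hasDerivAt_g x hx0) (C.g_pos x hx0).ne'
    have dF := ((dL.fun_mul (d1.fun_pow 2)).fun_sub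
      (((d1.fun_mul d2).fun_div (C.hasDerivAt_g x hx0) (C.g_pos x hx0).ne').const_mul
        (2 * c))).fun_sub (((C.hasDerivAt_σ x hx0).fun_mul (d2.fun_pow 2)).const_mul c)
    have e : deriv (boundary g g₁ σ Z u c) x = _ := dF.deriv
    rw [e]
    refine le_of_eq_of_le ?_ (C.pointwise hx0 (u x) (∫ t in (0 : ℝ)..x, u t)
      (∫ t in (0 : ℝ)..x, (∫ s in (0 : ℝ)..t, u s) * Z t))
    have hg := (C.g_pos x hx0).ne'
    simp only [Nat.cast_ofNat, Nat.add_one_sub_one, pow_one]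
    field_simp

theorem abs_boundary_le (C : Certificate g g₁ g₂ σ σ₁ Q Z c A β) {x w v W V L G S : ℝ}
    (hw : |w| ≤ W) (hv : |v| ≤ V) (hL : |g₁ x / g x| ≤ L) (hG : |1 / g x| ≤ G) (hS : |σ x| ≤ S) :
    |g₁ x / g x * w ^ 2 - 2 * c * (w * v / g x) - c * (σ x * v ^ 2)|
      ≤ L * W ^ 2 + 2 * c * (W * V * G) + c * (S * V ^ 2) := by
  have hc := C.c_nonneg
  have hW := (abs_nonneg _).trans hw
  have hV := (abs_nonneg _).trans hv
  have hL' := (abs_nonneg _).trans hL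
  have hS' := (abs_nonneg _).trans hS
  have e1 : |g₁ x / g x * w ^ 2| ≤ L * W ^ 2 := by
    rw [abs_mul, abs_pow]; gcongr
  have e2 : |2 * c * (w * v / g x)| ≤ 2 * c * (W * V * G) := by
    rw [div_eq_mul_one_div, abs_mul, abs_mul (w * v), abs_mul w, abs_of_nonneg (by positivity : 0 ≤ 2 * c)]
    gcongr
  have e3 : |c * (σ x * v ^ 2)| ≤ c * (S * V ^ 2) := by
    rw [abs_mul, abs_mul, abs_pow, abs_of_nonneg hc]; gcongr
  calc _ ≤ |g₁ x / g x * w ^ 2 - 2 * c * (w * v / g x)| + |c * (σ x * v ^ 2)| := abs_sub _ _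
    _ ≤ |g₁ x / g x * w ^ 2| + |2 * c * (w * v / g x)| + |c * (σ x * v ^ 2)| := by
      gcongr; exact abs_sub _ _
    _ ≤ _ := by gcongr

/-- The powers of `x` in the near bounds cancel, so every term is at most a constant times `∫₀ˣ u²`,
which tends to 0. -/
theorem tendsto_boundary_zero (C : Certificate g g₁ g₂ σ σ₁ Q Z c A β) (hu : MemLp u 2 volume) :
    Tendsto (boundary g g₁ σ Z u c) (𝓝[>] 0) (𝓝 0) := by
  have hA := C.A_nonneg
  have hc := C.c_nonneg
  set N : ℝ → ℝ := fun x => ∫ t in (0 : ℝ)..x, u t ^ 2 with hN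
  have hNc : Continuous N :=
    intervalIntegral.continuous_primitive (fun _ _ => hu.integrable_sq.intervalIntegrable) 0
  have hN0 : Tendsto (fun x => (A + 2 * c * A ^ 2 + c * A ^ 3) * N x) (𝓝[>] 0) (𝓝 0) := by
    have : Tendsto (fun x => (A + 2 * c * A ^ 2 + c * A ^ 3) * N x) (𝓝 0)
        (𝓝 ((A + 2 * c * A ^ 2 + c * A ^ 3) * N 0)) := (hNc.tendsto 0).const_mul _
    rw [show N 0 = 0 by simp [hN], mul_zero] at this
    exact this.mono_left nhdsWithin_le_nhds
  refine squeeze_zero_norm' ?_ hN0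
  filter_upwards [Ioc_mem_nhdsGT (zero_lt_one' ℝ)] with x hx
  obtain ⟨hx0, hx1⟩ := hx
  have hNx : 0 ≤ N x := intervalIntegral.integral_nonneg hx0.le fun t _ => sq_nonneg _
  have hV : |∫ t in (0 : ℝ)..x, (∫ s in (0 : ℝ)..t, u s) * Z t| ≤ A * x ^ 2 * √(x * N x) := by
    have := intervalIntegral.norm_integral_le_of_norm_le_const (a := 0) (b := x)
      (f := fun t => (∫ s in (0 : ℝ)..t, u s) * Z t) (C := √(x * N x) * (A * x)) (by
        intro t ht
        rw [uIoc_of_le hx0.le] at ht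
        rw [Real.norm_eq_abs, abs_mul, abs_of_pos (C.Z_pos t ht.1)]
        have h1 := abs_primitive_le hu ht.1
        have h2 : √(t * ∫ s in (0 : ℝ)..t, u s ^ 2) ≤ √(x * N x) := by
          refine Real.sqrt_le_sqrt (mul_le_mul ht.2 (integral_sq_mono hu ht.1.le ht.2) ?_ hx0.le)
          exact intervalIntegral.integral_nonneg ht.1.le fun t _ => sq_nonneg _
        have h3 : Z t ≤ A * x :=
          (C.near_Z t ht.1 (ht.2.trans hx1)).trans (mul_le_mul_of_nonneg_left ht.2 hA)
        exact mul_le_mul (h1.trans h2) h3 (C.Z_pos t ht.1).le (Real.sqrt_nonneg _))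
    rw [Real.norm_eq_abs, sub_zero, abs_of_pos hx0] at this
    linarith
  have hg := C.g_pos x hx0
  have hG : |1 / g x| ≤ A / x := by
    rw [abs_of_pos (by positivity)]; exact C.near_inv x hx0 hx1
  have := C.abs_boundary_le (abs_primitive_le hu hx0) hV (C.near_logDeriv x hx0 hx1) hG
    (C.near_σ x hx0 hx1)
  refine this.trans ?_
  have hsq : √(x * N x) ^ 2 = x * N x := Real.sq_sqrt (by positivity)
  change A / x * √(x * N x) ^ 2 + 2 * c * (√(x * N x) * (A * x ^ 2 * √(x * N x)) * (A / x))
    + c * (A / x ^ 3 * (A * x ^ 2 * √(x * N x)) ^ 2) ≤ _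
  have e : A / x * √(x * N x) ^ 2 + 2 * c * (√(x * N x) * (A * x ^ 2 * √(x * N x)) * (A / x))
      + c * (A / x ^ 3 * (A * x ^ 2 * √(x * N x)) ^ 2)
      = (A + 2 * c * A ^ 2 * x ^ 2 + c * A ^ 3 * x ^ 2) * N x := by
    have e1 : √(x * N x) * (A * x ^ 2 * √(x * N x)) = A * x ^ 2 * √(x * N x) ^ 2 := by ring
    rw [e1, mul_pow, hsq]
    field_simp
  rw [e]
  have hx2 : x ^ 2 ≤ 1 := pow_le_one₀ hx0.le hx1
  have t1 : 2 * c * A ^ 2 * x ^ 2 ≤ 2 * c * A ^ 2 * 1 := by gcongr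
  have t2 : c * A ^ 3 * x ^ 2 ≤ c * A ^ 3 * 1 := by gcongr
  exact mul_le_mul_of_nonneg_right (by linarith) hNx

theorem abs_primitive_mul_le (C : Certificate g g₁ g₂ σ σ₁ Q Z c A β) (hu : MemLp u 2 volume)
    {t : ℝ} (ht : 0 < t) :
    |(∫ s in (0 : ℝ)..t, u s) * Z t|
      ≤ √(∫ t, u t ^ 2) * (1 + 1 / β) * A * Real.exp (-(3 * β) * t) := by
  have hβ := C.β_pos
  rw [abs_mul, abs_of_pos (C.Z_pos t ht)]
  refine (mul_le_mul (abs_primitive_le_exp hu ht hβ) (C.far_Z t ht) (C.Z_pos t ht).le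
    (by positivity)).trans_eq ?_
  rw [show -(3 * β) * t = β * t + -(4 * β) * t by ring, Real.exp_add]
  ring

theorem integrableOn_primitive_mul (C : Certificate g g₁ g₂ σ σ₁ Q Z c A β)
    (hu : MemLp u 2 volume) :
    IntegrableOn (fun t => (∫ s in (0 : ℝ)..t, u s) * Z t) (Ioi 0) := by
  have hβ := C.β_pos
  refine Integrable.mono' ((integrableOn_exp_mul_Ioi (a := -(3 * β)) (by linarith) 0).const_mul
    (√(∫ t, u t ^ 2) * (1 + 1 / β) * A))
    ((continuous_primitive hu).mul C.continuous_Z).aestronglyMeasurable ?_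
  refine (ae_restrict_iff' measurableSet_Ioi).mpr (Eventually.of_forall fun t ht => ?_)
  exact C.abs_primitive_mul_le hu ht

theorem integrableOn_potential (C : Certificate g g₁ g₂ σ σ₁ Q Z c A β)
    (hu : MemLp u 2 volume) :
    IntegrableOn (fun t => Q t * (∫ s in (0 : ℝ)..t, u s) ^ 2) (Ioi 0) := by
  have hβ := C.β_pos
  have hA := C.A_nonneg
  set K := √(∫ t, u t ^ 2) * (1 + 1 / (β / 4)) with hK
  refine Integrable.mono' ((integrableOn_exp_mul_Ioi (a := -(β / 2)) (by linarith) 0).const_mul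
    (A * K ^ 2)) (C.continuous_Q.mul ((continuous_primitive hu).pow 2)).aestronglyMeasurable ?_
  refine (ae_restrict_iff' measurableSet_Ioi).mpr (Eventually.of_forall fun t ht => ?_)
  have h1 := abs_primitive_le_exp hu ht (by positivity : 0 < β / 4)
  rw [Real.norm_eq_abs, abs_mul, abs_pow]
  calc _ ≤ (A * Real.exp (-β * t)) * (K * Real.exp (β / 4 * t)) ^ 2 := by
        gcongr
        exact C.far_Q t ht
    _ = A * K ^ 2 * Real.exp (-(β / 2) * t) := by
        rw [mul_pow, ← Real.exp_nat_mul]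
        rw [show -(β / 2) * t = -β * t + ((2 : ℕ) : ℝ) * (β / 4 * t) by push_cast; ring, Real.exp_add]
        ring

/-- Orthogonality enters here: it turns `∫₀ˣ W Z` into minus the tail integral, of size `exp
(-3βx)`. Its square beats the growth `exp (4βx)` allowed for `σ`. -/
theorem tendsto_boundary_atTop (C : Certificate g g₁ g₂ σ σ₁ Q Z c A β) (hu : MemLp u 2 volume)
    (h0 : ∫ x in Ioi 0, (∫ t in (0 : ℝ)..x, u t) * Z x = 0) :
    Tendsto (boundary g g₁ σ Z u c) atTop (𝓝 0) := by
  have hβ := C.β_pos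
  have hA := C.A_nonneg
  have hc := C.c_nonneg
  set K := √(∫ t, u t ^ 2) * (1 + 1 / (β / 4)) with hK
  set M := √(∫ t, u t ^ 2) * (1 + 1 / β) * A / (3 * β) with hM
  have hint := C.integrableOn_primitive_mul hu
  have hV : ∀ x, 1 ≤ x → |∫ t in (0 : ℝ)..x, (∫ s in (0 : ℝ)..t, u s) * Z t|
      ≤ M * Real.exp (-(3 * β) * x) := by
    intro x hx
    have e : (∫ t in (0 : ℝ)..x, (∫ s in (0 : ℝ)..t, u s) * Z t)
        + ∫ t in Ioi x, (∫ s in (0 : ℝ)..t, u s) * Z t = 0 := by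
      exact (intervalIntegral.integral_interval_add_Ioi hint
        (hint.mono_set (Ioi_subset_Ioi (by linarith)))).trans h0
    rw [eq_neg_of_add_eq_zero_left e, abs_neg]
    have hb : ∀ᵐ t ∂volume.restrict (Ioi x), ‖(∫ s in (0 : ℝ)..t, u s) * Z t‖
        ≤ √(∫ t, u t ^ 2) * (1 + 1 / β) * A * Real.exp (-(3 * β) * t) :=
      (ae_restrict_iff' measurableSet_Ioi).mpr (Eventually.of_forall fun t ht =>
        C.abs_primitive_mul_le hu (by linarith [mem_Ioi.mp ht]))
    refine (norm_integral_le_of_norm_le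
      ((integrableOn_exp_mul_Ioi (a := -(3 * β)) (by linarith) x).const_mul _) hb).trans_eq ?_
    rw [integral_const_mul, integral_exp_mul_Ioi (by linarith), hM]
    field_simp
  have hlim : Tendsto (fun x => (A * K ^ 2 + 2 * c * (K * M * A) + c * (A * M ^ 2))
      * Real.exp (-(β / 2) * x)) atTop (𝓝 0) := by
    have : Tendsto (fun x => Real.exp (-(β / 2) * x)) atTop (𝓝 0) :=
      Real.tendsto_exp_atBot.comp (tendsto_id.const_mul_atTop_of_neg (by linarith))
    simpa using this.const_mul (A * K ^ 2 + 2 * c * (K * M * A) + c * (A * M ^ 2))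
  refine squeeze_zero_norm' ?_ hlim
  filter_upwards [eventually_ge_atTop 1] with x hx
  have hx0 : 0 < x := by linarith
  have hg := C.g_pos x hx0
  have hG : |1 / g x| ≤ A := by
    rw [abs_of_pos (by positivity)]; exact C.far_inv x hx
  have := C.abs_boundary_le (abs_primitive_le_exp hu hx0 (by positivity : 0 < β / 4)) (hV x hx)
    (C.far_logDeriv x hx) hG (C.far_σ x hx)
  refine this.trans ?_
  have hK0 : 0 ≤ K := by positivity
  have hM0 : 0 ≤ M := by positivity
  have x1 : A * Real.exp (-β * x) * (K * Real.exp (β / 4 * x)) ^ 2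
      = A * K ^ 2 * Real.exp (-(β / 2) * x) := by
    rw [mul_pow, ← Real.exp_nat_mul,
      show -(β / 2) * x = -β * x + ((2 : ℕ) : ℝ) * (β / 4 * x) by push_cast; ring, Real.exp_add]
    ring
  have x2 : K * Real.exp (β / 4 * x) * (M * Real.exp (-(3 * β) * x)) * A
      ≤ K * M * A * Real.exp (-(β / 2) * x) := by
    have : Real.exp (β / 4 * x) * Real.exp (-(3 * β) * x) ≤ Real.exp (-(β / 2) * x) := by
      rw [← Real.exp_add]; apply Real.exp_le_exp.mpr; nlinarith
    calc _ = K * M * A * (Real.exp (β / 4 * x) * Real.exp (-(3 * β) * x)) := by ring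
      _ ≤ _ := by gcongr
  have x3 : A * Real.exp (4 * β * x) * (M * Real.exp (-(3 * β) * x)) ^ 2
      ≤ A * M ^ 2 * Real.exp (-(β / 2) * x) := by
    have : Real.exp (4 * β * x) * Real.exp (-(3 * β) * x) ^ 2 ≤ Real.exp (-(β / 2) * x) := by
      rw [← Real.exp_nat_mul, ← Real.exp_add]; apply Real.exp_le_exp.mpr; push_cast; nlinarith
    calc _ = A * M ^ 2 * (Real.exp (4 * β * x) * Real.exp (-(3 * β) * x) ^ 2) := by ring
      _ ≤ _ := by gcongr
  have y2 := mul_le_mul_of_nonneg_left x2 (by positivity : 0 ≤ 2 * c)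
  have y3 := mul_le_mul_of_nonneg_left x3 hc
  rw [← hK, x1]
  linarith

/-- The quadratic form is nonnegative on the orthogonal complement of `Z`. -/
theorem integral_nonneg (C : Certificate g g₁ g₂ σ σ₁ Q Z c A β) (hu : MemLp u 2 volume)
    (h0 : ∫ x in Ioi 0, (∫ t in (0 : ℝ)..x, u t) * Z x = 0) :
    0 ≤ ∫ x in Ioi 0, (u x ^ 2 - Q x * (∫ t in (0 : ℝ)..x, u t) ^ 2) := by
  set h : ℝ → ℝ := fun x => u x ^ 2 - Q x * (∫ t in (0 : ℝ)..x, u t) ^ 2 with hh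
  have hi : IntegrableOn h (Ioi 0) := hu.integrable_sq.integrableOn.sub (C.integrableOn_potential hu)
  have hloc : ∀ a b, IntervalIntegrable h volume a b := fun a b =>
    hu.integrable_sq.intervalIntegrable.sub
      ((C.continuous_Q.mul ((continuous_primitive hu).pow 2)).intervalIntegrable _ _)
  have hH : Continuous fun x => ∫ t in (0 : ℝ)..x, h t :=
    intervalIntegral.continuous_primitive hloc 0
  have t1 : Tendsto (fun x => ∫ t in (0 : ℝ)..x, h t) (𝓝[>] 0) (𝓝 0) := by
    have := (hH.tendsto 0).mono_left (nhdsWithin_le_nhds (s := Ioi 0))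
    simpa using this
  have t2 := intervalIntegral_tendsto_integral_Ioi 0 hi tendsto_id
  have step : ∀ b, 0 < b → boundary g g₁ σ Z u c b ≤ ∫ t in (0 : ℝ)..b, h t := by
    intro b hb
    have l := (tendsto_const_nhds (x := boundary g g₁ σ Z u c b)).sub (C.tendsto_boundary_zero hu)
    have r := (tendsto_const_nhds (x := ∫ t in (0 : ℝ)..b, h t)).sub t1
    rw [sub_zero] at l r
    refine le_of_tendsto_of_tendsto l r ?_
    filter_upwards [Ioc_mem_nhdsGT hb] with a ha
    rw [intervalIntegral.integral_interval_sub_left (hloc _ _) (hloc _ _)]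
    exact C.boundary_sub_le hu ha.1 ha.2
  refine le_of_tendsto_of_tendsto (C.tendsto_boundary_atTop hu h0) t2 ?_
  filter_upwards [eventually_gt_atTop 0] with b hb
  exact step b hb

end Certificate

/-! ### Polynomial inequalities -/

/-- This is the Riccati inequality multiplied by `20 sinh⁴ (x/2)`, after `tanh (x/8)` and `cosh
(x/8)` are replaced by their rational bounds in `d`. -/
theorem riccati_polynomial {d X : ℝ} (hd : 1 ≤ d) (hX : X = 2 * d ^ 2 - 1) :
    (12 * d ^ 4 - 32 * d ^ 3 + 27 * d ^ 2 - 8 * d) ^ 2 * d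
        * ((2 * X ^ 2 + 12 * d ^ 2 * (d ^ 2 - 1)) * (2 * d * (1 + d) * (7 + d))
          + 4 * X ^ 3 * (3 + d)) * (15 + d) / (40 * X ^ 5 * (1 + d) * (7 + d))
      + 75 * (d ^ 2 - 1) * X ^ 6 * (5 + 3 * d) ^ 2
        / ((2 * X ^ 2 + 12 * d ^ 2 * (d ^ 2 - 1)) * (d * (5 + 3 * d)) + 4 * X ^ 3) ^ 2
      ≤ (48 * d ^ 3 - 96 * d ^ 2 + 54 * d - 8) * (d ^ 2 - 1)
        - 3 * (12 * d ^ 4 - 32 * d ^ 3 + 27 * d ^ 2 - 8 * d) * d := by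
  obtain ⟨u, rfl⟩ : ∃ u, d = 1 + u := ⟨d - 1, by ring⟩
  have hu : 0 ≤ u := by linarith
  have hX' : X = 1 + 4 * u + 2 * u ^ 2 := by rw [hX]; ring
  have hXp : 0 < X := by rw [hX']; positivity
  have hE : (1 + u) ^ 2 - 1 = u * (2 + u) := by ring
  rw [hE]
  rw [div_add_div _ _ (by positivity) (by positivity), div_le_iff₀ (by positivity), ← sub_nonneg]
  -- After clearing denominators and expanding in `u = d - 1`, every coefficient is positive.
  have key : 0 ≤ 256000 + 8256000 * u + 101252800 * u ^ 2 + 734033600 * u ^ 3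
      + 6763272080 * u ^ 4 + 67383390720 * u ^ 5 + 462004447896 * u ^ 6
      + 2057658079856 * u ^ 7 + 6170391115072 * u ^ 8 + 13376639618160 * u ^ 9
      + 26230670273744 * u ^ 10 + 67479127711312 * u ^ 11 + 206782863809536 * u ^ 12
      + 541473286795728 * u ^ 13 + 1086698125765504 * u ^ 14 + 1663951178801952 * u ^ 15
      + 1967562615848832 * u ^ 16 + 1812398765890848 * u ^ 17 + 1302771604831680 * u ^ 18
      + 726057271787072 * u ^ 19 + 308496167920384 * u ^ 20 + 96772946889280 * u ^ 21
      + 21184086313728 * u ^ 22 + 2998446749056 * u ^ 23 + 341714508544 * u ^ 24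
      + 106341958528 * u ^ 25 + 40403300352 * u ^ 26 + 8627868672 * u ^ 27
      + 946606080 * u ^ 28 + 42252288 * u ^ 29 := by positivity
  refine key.trans_eq ?_
  rw [hX']
  ring

/-- The rapidly decaying part of the supersolution inequality, divided by `Z`. The term `352 = 22 ·
16` comes from `C ≤ (15 + d) / 16`, and `5/64` of the budget 15 is reserved for the slow part. -/
theorem fast_polynomial {d X : ℝ} (hd : 1 ≤ d) (hX : X = 2 * d ^ 2 - 1) :
    36 / X ^ 3 - 352 / (X * (15 + d))
      + 303 / 50 * ((d - 1) * (3 + d)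
        * ((2 * X ^ 2 + 12 * d ^ 2 * (d ^ 2 - 1)) * (2 * d * (1 + d) * (7 + d))
          + 4 * X ^ 3 * (3 + d))) / (X ^ 4 * (1 + d) * (7 + d)) ≤ 15 - 5 / 64 := by
  obtain ⟨u, rfl⟩ : ∃ u, d = 1 + u := ⟨d - 1, by ring⟩
  have hu : 0 ≤ u := by linarith
  have hX' : X = 1 + 4 * u + 2 * u ^ 2 := by rw [hX]; ring
  have hXp : 0 < X := by rw [hX']; positivity
  rw [← sub_nonneg]
  have key : 0 ≤ 377600 + 96996880 * u + 190740430 * u ^ 2 - 284676189 * u ^ 3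
      - 601046688 * u ^ 4 + 547864440 * u ^ 5 + 1820143088 * u ^ 6 + 1580207944 * u ^ 7
      + 651384832 * u ^ 8 + 133737440 * u ^ 9 + 12289888 * u ^ 10 + 382000 * u ^ 11 := by
    have h0 : 0 ≤ 1580207944 * u ^ 7 + 651384832 * u ^ 8 + 133737440 * u ^ 9
      + 12289888 * u ^ 10 + 382000 * u ^ 11 := by positivity
    -- Only the `u³` and `u⁴` coefficients are negative. For `u ≤ 1/2` the `u²` and `u` terms absorb
    -- them. For `u ≥ 1/2`, `127000000 u⁴` is borrowed from the higher terms so that the quadratic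
    -- factor has negative discriminant.
    rcases le_total u (1 / 2) with h | h
    · have h1 : 0 ≤ u ^ 2 * (190740430 - 284676189 * u) :=
        mul_nonneg (by positivity) (by linarith)
      have h2 : u ^ 3 ≤ (1 / 2) ^ 3 := by gcongr
      have h3 : 0 ≤ u * (96996880 - 601046688 * u ^ 3) :=
        mul_nonneg hu (by linarith)
      have h4 : 0 ≤ 547864440 * u ^ 5 + 1820143088 * u ^ 6 := by positivity
      linarith
    · have h1 : 0 ≤ u ^ 2 * (127000000 * u ^ 2 - 284676189 * u + 190740430) :=
        mul_nonneg (by positivity) (by nlinarith [sq_nonneg (u - 1.12)])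
      have h2 : 0 ≤ u ^ 4 * (1820143088 * u ^ 2 + 547864440 * u - 601046688 - 127000000) :=
        mul_nonneg (by positivity) (by nlinarith)
      have h3 : 0 ≤ 96996880 * u := by positivity
      linarith
  have e : 15 - 5 / 64 - (36 / X ^ 3 - 352 / (X * (15 + (1 + u)))
      + 303 / 50 * ((1 + u - 1) * (3 + (1 + u))
        * ((2 * X ^ 2 + 12 * (1 + u) ^ 2 * ((1 + u) ^ 2 - 1)) * (2 * (1 + u) * (1 + (1 + u))
          * (7 + (1 + u))) + 4 * X ^ 3 * (3 + (1 + u))))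
        / (X ^ 4 * (1 + (1 + u)) * (7 + (1 + u))))
      = (377600 + 96996880 * u + 190740430 * u ^ 2 - 284676189 * u ^ 3
      - 601046688 * u ^ 4 + 547864440 * u ^ 5 + 1820143088 * u ^ 6 + 1580207944 * u ^ 7
      + 651384832 * u ^ 8 + 133737440 * u ^ 9 + 12289888 * u ^ 10 + 382000 * u ^ 11)
      / (1600 * (X ^ 4 * (1 + (1 + u)) * (7 + (1 + u)) * (15 + (1 + u)))) := by
    have a1 : 1 + (1 + u) ≠ 0 := by positivity
    have a2 : 7 + (1 + u) ≠ 0 := by positivity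
    have a3 : 15 + (1 + u) ≠ 0 := by positivity
    have a4 : X ≠ 0 := hXp.ne'
    field_simp
    rw [hX']
    ring
  rw [e]
  positivity

/-- The slowly decaying part: `101/20 = (101/100)(2 + 3)`, `299/25 = 16 - 4 · 101/100` and `10 = 128
· 5/64`. -/
theorem slow_polynomial {d X : ℝ} (hd : 1 ≤ d) (hX : X = 2 * d ^ 2 - 1) :
    101 / 20 * X * (d * (5 + 3 * d)) - 299 / 25 * X ^ 2 ≤ 10 * (d * (5 + 3 * d)) := by
  obtain ⟨u, rfl⟩ : ∃ u, d = 1 + u := ⟨d - 1, by ring⟩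
  have hu : 0 ≤ u := by linarith
  subst hX
  nlinarith [mul_nonneg hu (sq_nonneg (u - 1)), mul_nonneg hu hu, sq_nonneg (u - 1),
    mul_nonneg (mul_nonneg hu hu) (sq_nonneg (u - 1)), sq_nonneg (u * (u - 1)), sq_nonneg (u ^ 2 - u - 1)]

/-! ### Multiple angles -/

/-- The values of `cosh` and `sinh` at `x / 8`, and those obtained by repeatedly doubling the
angle. -/
structure AngleData (C s k d e X S : ℝ) : Prop where
  one_lt_C : 1 < C
  s_pos : 0 < s
  sq_sub_sq : C ^ 2 - s ^ 2 = 1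
  k_eq : k = 2 * C ^ 2 - 1
  d_eq : d = 2 * k ^ 2 - 1
  X_eq : X = 2 * d ^ 2 - 1
  e_eq : e = 4 * s * C * k
  S_eq : S = 2 * d * e

theorem angleData {x : ℝ} (hx : 0 < x) :
    AngleData (Real.cosh (x / 8)) (Real.sinh (x / 8)) (Real.cosh (x / 4)) (Real.cosh (x / 2))
      (Real.sinh (x / 2)) (Real.cosh x) (Real.sinh x) := by
  have c2 : ∀ y, Real.cosh (2 * y) = 2 * Real.cosh y ^ 2 - 1 := fun y => by
    rw [Real.cosh_two_mul]; linarith [Real.cosh_sq y]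
  refine ⟨Real.one_lt_cosh.mpr (by positivity), Real.sinh_pos_iff.mpr (by positivity),
    by linarith [Real.cosh_sq (x / 8)], ?_, ?_, ?_, ?_, ?_⟩
  · rw [← c2]; ring_nf
  · rw [← c2]; ring_nf
  · rw [← c2]; ring_nf
  · rw [show x / 2 = 2 * (2 * (x / 8)) by ring, show x / 4 = 2 * (x / 8) by ring,
      Real.sinh_two_mul (2 * (x / 8)), Real.sinh_two_mul (x / 8)]
    ring
  · conv_lhs => rw [show x = 2 * (x / 2) by ring, Real.sinh_two_mul]
    ring

namespace AngleData

variable {C s k d e X S : ℝ}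

theorem one_lt_k (h : AngleData C s k d e X S) : 1 < k := by
  have := h.one_lt_C
  rw [h.k_eq]; nlinarith

theorem C_le_k (h : AngleData C s k d e X S) : C ≤ k := by
  have := h.one_lt_C
  rw [h.k_eq]; nlinarith

theorem one_lt_d (h : AngleData C s k d e X S) : 1 < d := by
  have := h.one_lt_k
  rw [h.d_eq]; nlinarith

theorem k_le_d (h : AngleData C s k d e X S) : k ≤ d := by
  have := h.one_lt_k
  rw [h.d_eq]; nlinarith

theorem sq_d_le_X (h : AngleData C s k d e X S) : d ^ 2 ≤ X := by
  have := h.one_lt_d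
  rw [h.X_eq]; nlinarith

theorem X_pos (h : AngleData C s k d e X S) : 0 < X := by
  have := h.one_lt_d
  have := h.sq_d_le_X
  nlinarith

theorem e_pos (h : AngleData C s k d e X S) : 0 < e := by
  have := h.one_lt_C
  have := h.one_lt_k
  have := h.s_pos
  rw [h.e_eq]; positivity

theorem S_pos (h : AngleData C s k d e X S) : 0 < S := by
  have := h.one_lt_d
  have := h.e_pos
  rw [h.S_eq]; positivity

theorem sq_e (h : AngleData C s k d e X S) : e ^ 2 = d ^ 2 - 1 := by
  have e1 : s ^ 2 = C ^ 2 - 1 := by linarith [h.sq_sub_sq]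
  calc e ^ 2 = 16 * s ^ 2 * C ^ 2 * k ^ 2 := by rw [h.e_eq]; ring
    _ = 16 * (C ^ 2 - 1) * C ^ 2 * k ^ 2 := by rw [e1]
    _ = d ^ 2 - 1 := by rw [h.d_eq, h.k_eq]; ring

theorem S_eq_mul (h : AngleData C s k d e X S) : S = 8 * s * C * k * d := by
  rw [h.S_eq, h.e_eq]; ring

theorem S_lt_X (h : AngleData C s k d e X S) : S < X := by
  have h1 := h.sq_e
  have h2 := h.e_pos
  have h3 := h.one_lt_d
  rw [h.S_eq, h.X_eq]
  nlinarith [sq_nonneg (d - e)]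

theorem tau_eq (h : AngleData C s k d e X S) : s / C = S / (4 * (1 + k) * k * d) := by
  have h1 := h.one_lt_C
  have h2 := h.one_lt_k
  have h3 := h.one_lt_d
  have h4 : 1 + k = 2 * C ^ 2 := by rw [h.k_eq]; ring
  rw [h4, h.S_eq_mul]
  field_simp
  ring

/-- By `tau_eq` this reduces to `4 (1 + k) k ≤ 5 + 3 d = 2 + 6 k²`, that is `2 (k - 1)² ≥ 0`. -/
theorem le_tau (h : AngleData C s k d e X S) : S / (d * (5 + 3 * d)) ≤ s / C := by
  have h2 := h.one_lt_k
  have h3 := h.one_lt_d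
  rw [h.tau_eq]
  refine div_le_div_of_nonneg_left h.S_pos.le (by positivity) ?_
  rw [mul_comm d]
  refine mul_le_mul_of_nonneg_right ?_ (by linarith)
  nlinarith [h.d_eq, sq_nonneg (k - 1)]

/-- In terms of `k` the claim is `4 k (k - 1)² ≥ 0`; like the lower bound, it is sharp at `k = 1`,
that is at `x = 0`. -/
theorem tau_le (h : AngleData C s k d e X S) :
    s / C ≤ S * (3 + d) / (2 * d * (1 + d) * (7 + d)) := by
  have h2 := h.one_lt_k
  have h3 := h.one_lt_d
  have hS := h.S_pos
  rw [h.tau_eq, div_le_div_iff₀ (by positivity) (by positivity)]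
  have key : (1 + d) * (7 + d) ≤ (3 + d) * (2 * (1 + k) * k) := by
    rw [h.d_eq]
    nlinarith [mul_nonneg (by linarith : 0 ≤ k) (sq_nonneg (k - 1))]
  calc S * (2 * d * (1 + d) * (7 + d)) = 2 * S * d * ((1 + d) * (7 + d)) := by ring
    _ ≤ 2 * S * d * ((3 + d) * (2 * (1 + k) * k)) := by gcongr
    _ = _ := by ring

theorem s_le (h : AngleData C s k d e X S) : s ≤ S * (3 + d) / (16 * d * (1 + d)) := by
  have h1 := h.one_lt_C
  have h2 := h.one_lt_k
  have h3 := h.one_lt_d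
  have hs := h.s_pos
  rw [le_div_iff₀ (by positivity), h.S_eq_mul]
  have key : 2 * (1 + d) ≤ C * (k * (3 + d)) := by
    have : 2 * (1 + d) ≤ k * (3 + d) := by
      rw [h.d_eq]; nlinarith [mul_nonneg (by linarith : 0 ≤ k) (sq_nonneg (k - 1))]
    nlinarith [mul_pos (by linarith : 0 < k) (by linarith : 0 < 3 + d)]
  calc s * (16 * d * (1 + d)) = 8 * s * d * (2 * (1 + d)) := by ring
    _ ≤ 8 * s * d * (C * (k * (3 + d))) := by gcongr
    _ = _ := by ring

/-- As a function of `C`, `d = 8 C⁴ - 8 C² + 1` lies above its tangent at `C = 1`, which has slope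
16. -/
theorem C_le (h : AngleData C s k d e X S) : C ≤ (15 + d) / 16 := by
  have h1 := h.one_lt_C
  have h2 := h.one_lt_k
  nlinarith [h.k_eq, h.d_eq]

/-- The pointwise inequality `g'' + θ q g ≤ 15 Z`. -/
theorem supersolution (h : AngleData C s k d e X S) :
    36 * (S / X) / X ^ 4 - 22 * (S / X) / X ^ 2 - s / C / (8 * C ^ 2)
      + 101 / 100 * (1 / (128 * C ^ 2) + 48 * s * C * (S / X) / X ^ 2)
        * (2 * (S / X) + 3 * (S / X) ^ 3 + 4 * (s / C)) ≤ 15 * (S / X / X * C) := by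
  have h1 := h.one_lt_C
  have h3 := h.one_lt_d
  have hs := h.s_pos
  have hS := h.S_pos
  have hX := h.X_pos
  have hX1 : 1 < X := by nlinarith [h.sq_d_le_X]
  set T := S / X with hT
  set τ := s / C with hτ
  have hT0 : 0 < T := by positivity
  have hT1 : T ≤ 1 := (div_le_one hX).mpr h.S_lt_X.le
  have hτ0 : 0 < τ := by positivity
  -- The part of the potential of size `1/C²` decays more slowly than `Z`, so `15 Z` cannot absorb
  -- it at infinity. It is cancelled by `-τ / (8 C²)`, the second derivative of the summand `4 tanh
  -- (x/8)` of `g`.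
  have slow : 101 / 100 * (1 / (128 * C ^ 2)) * (2 * T + 3 * T ^ 3 + 4 * τ) - τ / (8 * C ^ 2)
      ≤ 5 / 64 * (T / X * C) := by
    have hp := slow_polynomial h3.le h.X_eq
    have hT3 : T ^ 3 ≤ T := by nlinarith [mul_nonneg hT0.le hT0.le, mul_nonneg hT0.le (by linarith : 0 ≤ 1 - T)]
    have hl := h.le_tau
    rw [← hτ] at hl
    have a1 : 101 / 20 * T - 299 / 25 * τ ≤ 10 * T / X := by
      have e1 : 10 * T / X - 101 / 20 * T + 299 / 25 * (S / (d * (5 + 3 * d)))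
          = S * (10 * (d * (5 + 3 * d)) - (101 / 20 * X * (d * (5 + 3 * d)) - 299 / 25 * X ^ 2))
            / (X ^ 2 * (d * (5 + 3 * d))) := by
        rw [hT]; field_simp; ring
      have e2 : 0 ≤ 10 * T / X - 101 / 20 * T + 299 / 25 * (S / (d * (5 + 3 * d))) := by
        rw [e1]
        exact div_nonneg (mul_nonneg hS.le (by linarith)) (by positivity)
      linarith
    have a2 : 101 / 100 * (1 / (128 * C ^ 2)) * (2 * T + 3 * T ^ 3 + 4 * τ) - τ / (8 * C ^ 2)
        = (101 / 100 * (2 * T + 3 * T ^ 3 + 4 * τ) - 16 * τ) / (128 * C ^ 2) := by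
      field_simp; ring
    rw [a2, div_le_iff₀ (by positivity)]
    have a3 : T / X ≤ T / X * C ^ 3 :=
      le_mul_of_one_le_right (by positivity) (one_le_pow₀ h1.le)
    calc 101 / 100 * (2 * T + 3 * T ^ 3 + 4 * τ) - 16 * τ ≤ 10 * (T / X) := by
          have : 10 * T / X = 10 * (T / X) := by ring
          linarith
      _ ≤ 10 * (T / X * C ^ 3) := by linarith
      _ = _ := by ring
  -- The remaining terms are compared with `Z = T / X * C` after dividing by it.
  have fast : 36 * T / X ^ 4 - 22 * T / X ^ 2
      + 101 / 100 * (48 * s * C * T / X ^ 2) * (2 * T + 3 * T ^ 3 + 4 * τ)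
      ≤ (15 - 5 / 64) * (T / X * C) := by
    have hp := fast_polynomial h3.le h.X_eq
    have hg : 2 * T + 3 * T ^ 3 + 4 * τ
        ≤ 2 * T + 3 * T ^ 3 + 4 * (S * (3 + d) / (2 * d * (1 + d) * (7 + d))) := by
      linarith [h.tau_le]
    have hsg : s * (2 * T + 3 * T ^ 3 + 4 * τ) ≤ S * (3 + d) / (16 * d * (1 + d))
        * (2 * T + 3 * T ^ 3 + 4 * (S * (3 + d) / (2 * d * (1 + d) * (7 + d)))) :=
      mul_le_mul h.s_le hg (by positivity) (by positivity)
    have hS2 : S ^ 2 = 4 * d ^ 2 * (d ^ 2 - 1) := by rw [h.S_eq, mul_pow, mul_pow, h.sq_e]; ring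
    have b1 : 101 / 100 * 48 / X * (S * (3 + d) / (16 * d * (1 + d))
        * (2 * T + 3 * T ^ 3 + 4 * (S * (3 + d) / (2 * d * (1 + d) * (7 + d)))))
        = 303 / 50 * ((d - 1) * (3 + d)
        * ((2 * X ^ 2 + 12 * d ^ 2 * (d ^ 2 - 1)) * (2 * d * (1 + d) * (7 + d))
          + 4 * X ^ 3 * (3 + d))) / (X ^ 4 * (1 + d) * (7 + d)) := by
      have c1 : S * (2 * T + 3 * T ^ 3 + 4 * (S * (3 + d) / (2 * d * (1 + d) * (7 + d))))
          = S ^ 2 * (2 / X + 3 * S ^ 2 / X ^ 3 + 4 * ((3 + d) / (2 * d * (1 + d) * (7 + d)))) := by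
        rw [hT]; field_simp
      have c2 : S * (3 + d) / (16 * d * (1 + d))
          * (2 * T + 3 * T ^ 3 + 4 * (S * (3 + d) / (2 * d * (1 + d) * (7 + d))))
          = (3 + d) / (16 * d * (1 + d)) *
          (S * (2 * T + 3 * T ^ 3 + 4 * (S * (3 + d) / (2 * d * (1 + d) * (7 + d))))) := by ring
      rw [c2, c1, hS2]
      field_simp
      ring
    have b2 : 36 / X ^ 3 - 22 / (X * C) + 101 / 100 * 48 / X * (s * (2 * T + 3 * T ^ 3 + 4 * τ))
        ≤ 15 - 5 / 64 := by
      have c1 : 101 / 100 * 48 / X * (s * (2 * T + 3 * T ^ 3 + 4 * τ)) ≤ _ :=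
        mul_le_mul_of_nonneg_left hsg (by positivity : 0 ≤ 101 / 100 * 48 / X)
      rw [b1] at c1
      have c2 : 352 / (X * (15 + d)) ≤ 22 / (X * C) := by
        rw [div_le_div_iff₀ (by positivity) (by positivity)]
        nlinarith [mul_le_mul_of_nonneg_left h.C_le hX.le]
      linarith
    have b3 : 36 / (X ^ 3 * C) ≤ 36 / X ^ 3 :=
      div_le_div_of_nonneg_left (by norm_num) (by positivity)
        (le_mul_of_one_le_right (by positivity) h1.le)
    have b4 : 36 * T / X ^ 4 - 22 * T / X ^ 2
        + 101 / 100 * (48 * s * C * T / X ^ 2) * (2 * T + 3 * T ^ 3 + 4 * τ)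
        = (36 / (X ^ 3 * C) - 22 / (X * C)
          + 101 / 100 * 48 / X * (s * (2 * T + 3 * T ^ 3 + 4 * τ))) * (T / X * C) := by
      field_simp
    rw [b4]
    exact mul_le_mul_of_nonneg_right (by linarith) (by positivity)
  have e : 36 * T / X ^ 4 - 22 * T / X ^ 2 - τ / (8 * C ^ 2)
      + 101 / 100 * (1 / (128 * C ^ 2) + 48 * s * C * T / X ^ 2) * (2 * T + 3 * T ^ 3 + 4 * τ)
      = (101 / 100 * (1 / (128 * C ^ 2)) * (2 * T + 3 * T ^ 3 + 4 * τ) - τ / (8 * C ^ 2))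
      + (36 * T / X ^ 4 - 22 * T / X ^ 2
      + 101 / 100 * (48 * s * C * T / X ^ 2) * (2 * T + 3 * T ^ 3 + 4 * τ)) := by ring
  rw [e]
  linarith

/-- The pointwise Riccati inequality. -/
theorem riccati (h : AngleData C s k d e X S) :
    ((12 * d ^ 4 - 32 * d ^ 3 + 27 * d ^ 2 - 8 * d) / (10 * e ^ 3)) ^ 2
        * ((2 * (S / X) + 3 * (S / X) ^ 3 + 4 * (s / C)) * (S / X / X * C))
      + 15 / (2 * (S / X) + 3 * (S / X) ^ 3 + 4 * (s / C)) ^ 2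
      ≤ ((48 * d ^ 3 - 96 * d ^ 2 + 54 * d - 8) * e ^ 2
        - 3 * (12 * d ^ 4 - 32 * d ^ 3 + 27 * d ^ 2 - 8 * d) * d) / (20 * e ^ 4) := by
  have h1 := h.one_lt_C
  have h3 := h.one_lt_d
  have hs := h.s_pos
  have hS := h.S_pos
  have hX := h.X_pos
  have he := h.e_pos
  have he2 := h.sq_e
  have hp := riccati_polynomial h3.le h.X_eq
  set N := 12 * d ^ 4 - 32 * d ^ 3 + 27 * d ^ 2 - 8 * d with hN
  set T := S / X with hT
  set τ := s / C with hτ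
  have hT0 : 0 < T := by positivity
  have hτ0 : 0 < τ := by positivity
  rw [← he2] at hp
  have hE : 0 < d ^ 2 - 1 := by rw [← he2]; positivity
  -- The left side increases with `τ` and `C` in its first term and decreases with `τ` in its
  -- second, so the upper and lower bounds for `τ` are used respectively.
  have a1 : (N / (10 * e ^ 3)) ^ 2 * ((2 * T + 3 * T ^ 3 + 4 * τ) * (T / X * C))
      ≤ (N / (10 * e ^ 3)) ^ 2 * ((2 * T + 3 * T ^ 3
        + 4 * (S * (3 + d) / (2 * d * (1 + d) * (7 + d)))) * (T / X * ((15 + d) / 16))) := by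
    gcongr
    · exact h.tau_le
    · exact h.C_le
  have a2 : 15 / (2 * T + 3 * T ^ 3 + 4 * τ) ^ 2
      ≤ 15 / (2 * T + 3 * T ^ 3 + 4 * (S / (d * (5 + 3 * d)))) ^ 2 := by
    gcongr
    exact h.le_tau
  have b1 : (N / (10 * e ^ 3)) ^ 2 * ((2 * T + 3 * T ^ 3
        + 4 * (S * (3 + d) / (2 * d * (1 + d) * (7 + d)))) * (T / X * ((15 + d) / 16)))
      = 1 / (20 * e ^ 4) * (N ^ 2 * d * ((2 * X ^ 2 + 12 * d ^ 2 * e ^ 2)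
        * (2 * d * (1 + d) * (7 + d)) + 4 * X ^ 3 * (3 + d)) * (15 + d)
        / (40 * X ^ 5 * (1 + d) * (7 + d))) := by
    rw [hT, h.S_eq]
    field_simp
    ring
  have b2 : 15 / (2 * T + 3 * T ^ 3 + 4 * (S / (d * (5 + 3 * d)))) ^ 2
      = 1 / (20 * e ^ 4) * (75 * e ^ 2 * X ^ 6 * (5 + 3 * d) ^ 2
        / ((2 * X ^ 2 + 12 * d ^ 2 * e ^ 2) * (d * (5 + 3 * d)) + 4 * X ^ 3) ^ 2) := by
    have c1 : 2 * T + 3 * T ^ 3 + 4 * (S / (d * (5 + 3 * d)))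
        = 2 * e * ((2 * X ^ 2 + 12 * d ^ 2 * e ^ 2) * (d * (5 + 3 * d)) + 4 * X ^ 3)
          / (X ^ 3 * (5 + 3 * d)) := by
      rw [hT, h.S_eq]
      field_simp
      ring
    rw [c1]
    field_simp
    ring
  refine (add_le_add a1 a2).trans ?_
  rw [b1, b2, ← mul_add]
  refine (mul_le_mul_of_nonneg_left hp (by positivity)).trans_eq ?_
  ring

end AngleData

/-! ### The certificate for the virial potential -/

/-- The potential `2 V (√2 y)` at scale `λ = 8`. -/
noncomputable def scaledPotential (x : ℝ) : ℝ :=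
  1 / (128 * Real.cosh (x / 8) ^ 2)
    + 48 * Real.sinh (x / 8) * Real.cosh (x / 8) * (Real.sinh x / Real.cosh x) / Real.cosh x ^ 2

/-- The function `Z₁ (√2 y)` at scale `λ = 8`, without its normalisation. -/
noncomputable def scaledMode (x : ℝ) : ℝ :=
  Real.sinh x / Real.cosh x / Real.cosh x * Real.cosh (x / 8)

/-- A positive function `g` with `g'' + (101/100) q g ≤ 15 Z`. -/
noncomputable def supersol (x : ℝ) : ℝ :=
  -- The coefficient 4 makes the slow terms favourable at infinity: multiplied by `128 cosh² (x/8)`,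
  -- they tend to `(101/100)(2 + 3 + 4) - 16 < 0`.
  2 * (Real.sinh x / Real.cosh x) + 3 * (Real.sinh x / Real.cosh x) ^ 3
    + 4 * (Real.sinh (x / 8) / Real.cosh (x / 8))

/-- The derivative of `supersol`. -/
noncomputable def supersolDeriv (x : ℝ) : ℝ :=
  (2 + 9 * (Real.sinh x / Real.cosh x) ^ 2) / Real.cosh x ^ 2 + 1 / (2 * Real.cosh (x / 8) ^ 2)

/-- The second derivative of `supersol`. -/
noncomputable def supersolDeriv₂ (x : ℝ) : ℝ :=
  36 * (Real.sinh x / Real.cosh x) / Real.cosh x ^ 4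
    - 22 * (Real.sinh x / Real.cosh x) / Real.cosh x ^ 2
    - Real.sinh (x / 8) / Real.cosh (x / 8) / (8 * Real.cosh (x / 8) ^ 2)

/-- A solution of the Riccati inequality `σ' ≥ σ² g Z + 15 / g²`. -/
noncomputable def riccatiSol (x : ℝ) : ℝ :=
  -- At 0 the numerator is `-1`, so `σ ≈ -(4/5) x⁻³`. There `g Z ≈ (5/2) x²`, and `-a x⁻³` satisfies
  -- the Riccati inequality to leading order when `3 a ≥ (5/2) a²`. At infinity `σ ≈ (6/5) cosh
  -- (x/2)`.
  (12 * Real.cosh (x / 2) ^ 4 - 32 * Real.cosh (x / 2) ^ 3 + 27 * Real.cosh (x / 2) ^ 2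
    - 8 * Real.cosh (x / 2)) / (10 * Real.sinh (x / 2) ^ 3)

/-- The derivative of `riccatiSol`. -/
noncomputable def riccatiSolDeriv (x : ℝ) : ℝ :=
  ((48 * Real.cosh (x / 2) ^ 3 - 96 * Real.cosh (x / 2) ^ 2 + 54 * Real.cosh (x / 2) - 8)
      * Real.sinh (x / 2) ^ 2
    - 3 * (12 * Real.cosh (x / 2) ^ 4 - 32 * Real.cosh (x / 2) ^ 3 + 27 * Real.cosh (x / 2) ^ 2
      - 8 * Real.cosh (x / 2)) * Real.cosh (x / 2)) / (20 * Real.sinh (x / 2) ^ 4)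

theorem hasDerivAt_sinh_div_cosh (a x : ℝ) :
    HasDerivAt (fun y => Real.sinh (y / a) / Real.cosh (y / a)) (1 / a / Real.cosh (x / a) ^ 2) x := by
  have h0 : HasDerivAt (fun y : ℝ => y / a) (1 / a) x := (hasDerivAt_id x).div_const a
  have h := h0.sinh.fun_div h0.cosh (Real.cosh_pos (x / a)).ne'
  refine h.congr_deriv ?_
  have hs := Real.cosh_sq (x / a)
  rw [div_left_inj' (pow_pos (Real.cosh_pos (x / a)) 2).ne']
  linear_combination (1 / a) * hs

theorem hasDerivAt_supersol (x : ℝ) : HasDerivAt supersol (supersolDeriv x) x := by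
  have h1 := hasDerivAt_sinh_div_cosh 1 x
  simp only [div_one] at h1
  have h := ((h1.const_mul 2).fun_add ((h1.fun_pow 3).const_mul 3)).fun_add
    ((hasDerivAt_sinh_div_cosh 8 x).const_mul 4)
  refine h.congr_deriv ?_
  have := (Real.cosh_pos x).ne'
  have := (Real.cosh_pos (x / 8)).ne'
  simp only [supersolDeriv]
  norm_num
  field_simp
  ring

theorem supersolDeriv_nonneg (x : ℝ) : 0 ≤ supersolDeriv x := by
  unfold supersolDeriv
  positivity

theorem hasDerivAt_supersolDeriv (x : ℝ) : HasDerivAt supersolDeriv (supersolDeriv₂ x) x := by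
  have h1 := hasDerivAt_sinh_div_cosh 1 x
  simp only [div_one] at h1
  have h0 : HasDerivAt (fun y : ℝ => y / 8) (1 / 8) x := (hasDerivAt_id x).div_const 8
  have hX := (Real.cosh_pos x).ne'
  have hC := (Real.cosh_pos (x / 8)).ne'
  have h := ((((h1.fun_pow 2).const_mul 9).const_add 2).fun_div
    ((Real.hasDerivAt_cosh x).fun_pow 2) (pow_ne_zero 2 hX)).fun_add
    ((hasDerivAt_const x (1 : ℝ)).fun_div ((h0.cosh.fun_pow 2).const_mul 2)
      (mul_ne_zero two_ne_zero (pow_ne_zero 2 hC)))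
  refine h.congr_deriv ?_
  have hs := Real.sinh_sq x
  simp only [supersolDeriv₂]
  norm_num
  field_simp
  have e3 : Real.sinh x ^ 3 = Real.sinh x * (Real.cosh x ^ 2 - 1) := by rw [← hs]; ring
  ring_nf
  rw [e3]
  ring

theorem hasDerivAt_riccatiSol {x : ℝ} (hx : 0 < x) :
    HasDerivAt riccatiSol (riccatiSolDeriv x) x := by
  have h0 : HasDerivAt (fun y : ℝ => y / 2) (1 / 2) x := (hasDerivAt_id x).div_const 2
  have he : Real.sinh (x / 2) ≠ 0 := (Real.sinh_pos_iff.mpr (by positivity)).ne'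
  have hd := h0.cosh
  have h := (((((hd.fun_pow 4).const_mul 12).fun_sub ((hd.fun_pow 3).const_mul 32)).fun_add
    ((hd.fun_pow 2).const_mul 27)).fun_sub (hd.const_mul 8)).fun_div
    ((h0.sinh.fun_pow 3).const_mul 10) (mul_ne_zero (by norm_num) (pow_ne_zero 3 he))
  refine h.congr_deriv ?_
  simp only [riccatiSolDeriv]
  norm_num
  field_simp
  ring

theorem continuous_scaledPotential : Continuous scaledPotential := by
  have h1 : ∀ x, Real.cosh x ≠ 0 := fun x => (Real.cosh_pos x).ne'
  have h2 : ∀ x : ℝ, 128 * Real.cosh (x / 8) ^ 2 ≠ 0 := fun x =>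
    mul_ne_zero (by norm_num) (pow_ne_zero 2 (h1 _))
  have h3 : ∀ x : ℝ, Real.cosh x ^ 2 ≠ 0 := fun x => pow_ne_zero 2 (h1 _)
  unfold scaledPotential
  fun_prop (disch := assumption)

theorem continuous_scaledMode : Continuous scaledMode := by
  have h1 : ∀ x, Real.cosh x ≠ 0 := fun x => (Real.cosh_pos x).ne'
  unfold scaledMode
  fun_prop (disch := assumption)

theorem continuous_supersolDeriv₂ : Continuous supersolDeriv₂ := by
  have h1 : ∀ x, Real.cosh x ≠ 0 := fun x => (Real.cosh_pos x).ne'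
  have h2 : ∀ x : ℝ, 8 * Real.cosh (x / 8) ^ 2 ≠ 0 := fun x =>
    mul_ne_zero (by norm_num) (pow_ne_zero 2 (h1 _))
  have h3 : ∀ x : ℝ, Real.cosh x ^ 2 ≠ 0 := fun x => pow_ne_zero 2 (h1 _)
  have h4 : ∀ x : ℝ, Real.cosh x ^ 4 ≠ 0 := fun x => pow_ne_zero 4 (h1 _)
  have h5 : ∀ x : ℝ, Real.cosh (x / 8) ≠ 0 := fun x => h1 _
  unfold supersolDeriv₂
  fun_prop (disch := assumption)

theorem continuousOn_riccatiSolDeriv : ContinuousOn riccatiSolDeriv (Ioi 0) := by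
  have h : ∀ x ∈ Ioi (0 : ℝ), 20 * Real.sinh (x / 2) ^ 4 ≠ 0 := fun x hx =>
    mul_ne_zero (by norm_num)
      (pow_ne_zero 4 (Real.sinh_pos_iff.mpr (half_pos hx)).ne')
  unfold riccatiSolDeriv
  fun_prop (disch := assumption)

/-! ### Size of the certificate near 0 and at infinity -/

theorem inv_cosh_le (t : ℝ) : 1 / Real.cosh t ≤ 2 * Real.exp (-t) := by
  rw [div_le_iff₀ (Real.cosh_pos t), Real.cosh_eq]
  have : Real.exp (-t) * Real.exp t = 1 := by rw [← Real.exp_add]; simp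
  nlinarith [Real.exp_pos (-t)]

theorem cosh_le_exp {t : ℝ} (ht : 0 ≤ t) : Real.cosh t ≤ Real.exp t := by
  rw [Real.cosh_eq]
  have : Real.exp (-t) ≤ Real.exp t := Real.exp_le_exp.mpr (by linarith)
  linarith

theorem sinh_le_two_mul_mul_cosh {x : ℝ} (hx : 0 ≤ x) : Real.sinh x ≤ 2 * x * Real.cosh x := by
  have h1 : Real.exp x ≤ 2 * Real.cosh x := by
    rw [Real.cosh_eq]; linarith [Real.exp_pos (-x)]
  have h2 : Real.exp x * Real.exp (-(2 * x)) = Real.exp (-x) := by rw [← Real.exp_add]; ring_nf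
  have h3 := mul_le_mul_of_nonneg_left (Real.add_one_le_exp (-(2 * x))) (Real.exp_pos x).le
  have h4 := mul_le_mul_of_nonneg_left h1 hx
  rw [Real.sinh_eq]
  nlinarith

namespace AngleData

variable {C s k d e X S : ℝ}

theorem supersol_pos (h : AngleData C s k d e X S) :
    0 < 2 * (S / X) + 3 * (S / X) ^ 3 + 4 * (s / C) := by
  have := h.one_lt_C
  have := h.s_pos
  have := h.S_pos
  have := h.X_pos
  positivity

theorem supersolDeriv_le (h : AngleData C s k d e X S) :
    (2 + 9 * (S / X) ^ 2) / X ^ 2 + 1 / (2 * C ^ 2) ≤ 12 * (1 / C) := by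
  have h1 := h.one_lt_C
  have h2 := h.one_lt_k
  have h3 := h.one_lt_d
  have hS := h.S_pos
  have hX := h.X_pos
  have hT : S / X ≤ 1 := (div_le_one hX).mpr h.S_lt_X.le
  have hT0 : 0 ≤ S / X := by positivity
  have hCX : C ≤ X := by nlinarith [h.C_le_k, h.k_le_d, h.sq_d_le_X]
  have a1 : (2 + 9 * (S / X) ^ 2) / X ^ 2 ≤ 11 / C := by
    have : (S / X) ^ 2 ≤ 1 := pow_le_one₀ hT0 hT
    have : C ≤ X ^ 2 := by nlinarith
    gcongr
    linarith
  have a2 : 1 / (2 * C ^ 2) ≤ 1 / C := by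
    apply one_div_le_one_div_of_le <;> nlinarith
  calc _ ≤ 11 / C + 1 / C := add_le_add a1 a2
    _ = _ := by ring

theorem potential_nonneg (h : AngleData C s k d e X S) :
    0 ≤ 1 / (128 * C ^ 2) + 48 * s * C * (S / X) / X ^ 2 := by
  have := h.one_lt_C
  have := h.s_pos
  have := h.S_pos
  have := h.X_pos
  positivity

theorem potential_le (h : AngleData C s k d e X S) :
    1 / (128 * C ^ 2) + 48 * s * C * (S / X) / X ^ 2 ≤ 49 * (1 / C) := by
  have h1 := h.one_lt_C
  have h3 := h.one_lt_d
  have hs := h.s_pos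
  have hS := h.S_pos
  have hX := h.X_pos
  have hT : S / X ≤ 1 := (div_le_one hX).mpr h.S_lt_X.le
  have hsC : s ≤ C := by nlinarith [h.sq_sub_sq]
  have hCd : C ≤ d := h.C_le_k.trans h.k_le_d
  have a1 : 1 / (128 * C ^ 2) ≤ 1 / C := by
    apply one_div_le_one_div_of_le <;> nlinarith
  have hX2 : C ^ 2 ≤ X := (pow_le_pow_left₀ (by linarith) hCd 2).trans h.sq_d_le_X
  have a2 : 48 * s * C * (S / X) / X ^ 2 ≤ 48 * (1 / C) := by
    calc 48 * s * C * (S / X) / X ^ 2 ≤ 48 * C * C * 1 / (C ^ 2) ^ 2 := by gcongr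
      _ = 48 / C ^ 2 := by field_simp
      _ ≤ 48 / C := by
        apply div_le_div_of_nonneg_left <;> nlinarith
      _ = _ := by ring
  linarith

theorem mode_pos (h : AngleData C s k d e X S) : 0 < S / X / X * C := by
  have := h.one_lt_C
  have := h.S_pos
  have := h.X_pos
  positivity

theorem mode_le (h : AngleData C s k d e X S) : S / X / X * C ≤ 1 / d := by
  have h1 := h.one_lt_C
  have h3 := h.one_lt_d
  have hS := h.S_pos
  have hX := h.X_pos
  have hT : S / X ≤ 1 := (div_le_one hX).mpr h.S_lt_X.le
  calc S / X / X * C ≤ 1 / d ^ 2 * d := by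
        gcongr
        · exact h.sq_d_le_X
        · exact h.C_le_k.trans h.k_le_d
    _ = 1 / d := by field_simp

theorem mode_le_div (h : AngleData C s k d e X S) : S / X / X * C ≤ S / X := by
  have hS := h.S_pos
  have hX := h.X_pos
  have hCX : C ≤ X := by nlinarith [h.one_lt_d, h.C_le_k, h.k_le_d, h.sq_d_le_X]
  rw [div_mul_eq_mul_div, div_le_iff₀ hX]
  gcongr

theorem abs_numerator_le (h : AngleData C s k d e X S) :
    |12 * d ^ 4 - 32 * d ^ 3 + 27 * d ^ 2 - 8 * d| ≤ 34 * d ^ 4 := by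
  obtain ⟨u, rfl⟩ : ∃ u, d = 1 + u := ⟨d - 1, by ring⟩
  have hu : 0 ≤ u := by linarith [h.one_lt_d]
  have e1 : 12 * (1 + u) ^ 4 - 32 * (1 + u) ^ 3 + 27 * (1 + u) ^ 2 - 8 * (1 + u)
      = -1 - 2 * u + 3 * u ^ 2 + 16 * u ^ 3 + 12 * u ^ 4 := by ring
  have e2 : 34 * (1 + u) ^ 4
      = 34 + 136 * u + 204 * u ^ 2 + 136 * u ^ 3 + 34 * u ^ 4 := by ring
  have p2 : 0 ≤ u ^ 2 := by positivity
  have p3 : 0 ≤ u ^ 3 := by positivity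
  have p4 : 0 ≤ u ^ 4 := by positivity
  rw [e1, e2, abs_le]
  constructor <;> linarith

end AngleData

theorem supersol_near {x : ℝ} (hx : 0 < x) (hx1 : x ≤ 1) : x / 6 ≤ supersol x := by
  have h := angleData hx
  have hS := h.S_pos
  have hX := h.X_pos
  have h1 : x ≤ Real.sinh x := Real.self_le_sinh_iff.mpr hx.le
  have h2 : Real.cosh x ≤ 3 :=
    (cosh_le_exp hx.le).trans ((Real.exp_le_exp.mpr hx1).trans (by linarith [Real.exp_one_lt_d9]))
  have h3 : x / 3 ≤ Real.sinh x / Real.cosh x := by gcongr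
  have h4 : 0 < Real.sinh (x / 8) / Real.cosh (x / 8) := div_pos h.s_pos (by linarith [h.one_lt_C])
  have h5 : 0 ≤ (Real.sinh x / Real.cosh x) ^ 3 := by positivity
  unfold supersol
  linarith

theorem half_angle_far {x : ℝ} (hx : 1 ≤ x) :
    Real.cosh (x / 2) ≤ 3 * Real.sinh (x / 2) := by
  have h := angleData (by linarith : 0 < x)
  have h1 : x / 2 ≤ Real.sinh (x / 2) := Real.self_le_sinh_iff.mpr (by linarith)
  have h2 := h.sq_e
  nlinarith [h.one_lt_d]

theorem supersol_far {x : ℝ} (hx : 1 ≤ x) : 1 / 2 ≤ supersol x := by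
  have h := angleData (by linarith : 0 < x)
  have hd := h.one_lt_d
  have hX := h.X_pos
  have hS := h.S_pos
  have h1 := half_angle_far hx
  have h3 : 1 / 3 ≤ Real.sinh x / Real.cosh x := by
    rw [le_div_iff₀ hX, h.S_eq, h.X_eq]
    nlinarith
  have h4 : 0 < Real.sinh (x / 8) / Real.cosh (x / 8) := div_pos h.s_pos (by linarith [h.one_lt_C])
  have h5 : 0 ≤ (Real.sinh x / Real.cosh x) ^ 3 := by positivity
  unfold supersol
  linarith

theorem supersolDeriv_le {x : ℝ} (hx : 0 < x) : supersolDeriv x ≤ 24 * Real.exp (-(1 / 8) * x) := by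
  have h := (angleData hx).supersolDeriv_le
  have h2 := inv_cosh_le (x / 8)
  rw [show -(x / 8) = -(1 / 8) * x by ring] at h2
  unfold supersolDeriv
  linarith

theorem abs_riccatiSol_le {x : ℝ} (hx : 0 < x) :
    |riccatiSol x| ≤ 17 / 5 * (Real.cosh (x / 2) ^ 4 / Real.sinh (x / 2) ^ 3) := by
  have h := angleData hx
  have he := h.e_pos
  unfold riccatiSol
  rw [abs_div, abs_of_pos (by positivity : 0 < 10 * Real.sinh (x / 2) ^ 3),
    div_le_iff₀ (by positivity)]
  refine h.abs_numerator_le.trans_eq ?_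
  field_simp
  norm_num

/-- The value `β = 1/8` makes `4β = 1/2` the growth rate of `σ`, and `Z` decays at least at that
rate. The constant 3000 is dictated by `near_σ`, which needs `17/5 · 3⁴ · 8 < 2204`. -/
theorem certificate : Certificate supersol supersolDeriv supersolDeriv₂ riccatiSol riccatiSolDeriv
    (fun x => 101 / 100 * scaledPotential x) scaledMode 15 3000 (1 / 8) where
  A_nonneg := by norm_num
  β_pos := by norm_num
  c_nonneg := by norm_num
  g_pos x hx := (angleData hx).supersol_pos
  Z_pos x hx := (angleData hx).mode_pos
  hasDerivAt_g x _ := hasDerivAt_supersol x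
  hasDerivAt_g₁ x _ := hasDerivAt_supersolDeriv x
  hasDerivAt_σ x hx := hasDerivAt_riccatiSol hx
  continuousOn_g₂ := continuous_supersolDeriv₂.continuousOn
  continuousOn_σ₁ := continuousOn_riccatiSolDeriv
  continuous_Q := continuous_scaledPotential.const_mul _
  continuous_Z := continuous_scaledMode
  supersolution x hx := (angleData hx).supersolution
  riccati x hx := (angleData hx).riccati
  near_logDeriv x hx hx1 := by
    have h0 : 0 ≤ supersolDeriv x := supersolDeriv_nonneg x
    have h1 : 0 < supersol x := (angleData hx).supersol_pos
    have h2 := supersol_near hx hx1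
    have h3 : supersolDeriv x ≤ 24 := (supersolDeriv_le hx).trans
      (by have := Real.exp_le_one_iff.mpr (by linarith : -(1 / 8) * x ≤ 0); linarith)
    rw [abs_of_nonneg (by positivity), div_le_div_iff₀ h1 hx]
    nlinarith
  near_inv x hx hx1 := by
    have h1 : 0 < supersol x := (angleData hx).supersol_pos
    have h2 := supersol_near hx hx1
    rw [div_le_div_iff₀ h1 hx]
    linarith
  near_σ x hx hx1 := by
    have h := angleData hx
    have hd := h.one_lt_d
    have he := h.e_pos
    have h1 : x / 2 ≤ Real.sinh (x / 2) := Real.self_le_sinh_iff.mpr (by linarith)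
    have h2 : Real.cosh (x / 2) ≤ 3 := (cosh_le_exp (by linarith)).trans
      ((Real.exp_le_exp.mpr (by linarith : x / 2 ≤ 1)).trans (by linarith [Real.exp_one_lt_d9]))
    calc |riccatiSol x| ≤ 17 / 5 * (Real.cosh (x / 2) ^ 4 / Real.sinh (x / 2) ^ 3) :=
          abs_riccatiSol_le hx
      _ ≤ 17 / 5 * (3 ^ 4 / (x / 2) ^ 3) := by gcongr
      _ = (17 / 5 * 3 ^ 4 * 8) / x ^ 3 := by field_simp; norm_num
      _ ≤ 3000 / x ^ 3 := by gcongr; norm_num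
  near_Z x hx _ := by
    have h := angleData hx
    refine h.mode_le_div.trans ?_
    rw [div_le_iff₀ h.X_pos]
    have := sinh_le_two_mul_mul_cosh hx.le
    nlinarith [mul_pos hx h.X_pos]
  far_logDeriv x hx := by
    have hx0 : 0 < x := by linarith
    have h0 : 0 ≤ supersolDeriv x := supersolDeriv_nonneg x
    have h1 : 0 < supersol x := (angleData hx0).supersol_pos
    have h2 := supersol_far hx
    rw [abs_of_nonneg (by positivity), div_le_iff₀ h1]
    have h3 := supersolDeriv_le hx0
    have h4 := Real.exp_pos (-(1 / 8) * x)
    nlinarith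
  far_inv x hx := by
    have h1 : 0 < supersol x := (angleData (by linarith)).supersol_pos
    have h2 := supersol_far hx
    rw [div_le_iff₀ h1]
    linarith
  far_σ x hx := by
    have hx0 : 0 < x := by linarith
    have h := angleData hx0
    have hd := h.one_lt_d
    have he := h.e_pos
    have h1 : Real.cosh (x / 2) / 3 ≤ Real.sinh (x / 2) := by linarith [half_angle_far hx]
    calc |riccatiSol x| ≤ 17 / 5 * (Real.cosh (x / 2) ^ 4 / Real.sinh (x / 2) ^ 3) :=
          abs_riccatiSol_le hx0
      _ ≤ 17 / 5 * (Real.cosh (x / 2) ^ 4 / (Real.cosh (x / 2) / 3) ^ 3) := by gcongr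
      _ = 17 / 5 * 27 * Real.cosh (x / 2) := by field_simp; norm_num
      _ ≤ 3000 * Real.exp (x / 2) := by
        have := cosh_le_exp (by linarith : 0 ≤ x / 2)
        linarith
      _ = 3000 * Real.exp (4 * (1 / 8) * x) := by ring_nf
  far_Z x hx := by
    have h := (angleData hx).mode_le
    have h2 := inv_cosh_le (x / 2)
    rw [show -(4 * (1 / 8)) * x = -(x / 2) by ring]
    have h4 := Real.exp_pos (-(x / 2))
    unfold scaledMode
    linarith
  far_Q x hx := by
    have h0 : 0 ≤ scaledPotential x := (angleData hx).potential_nonneg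
    have h : scaledPotential x ≤ 49 * (1 / Real.cosh (x / 8)) := (angleData hx).potential_le
    have h2 := inv_cosh_le (x / 8)
    rw [show -(1 / 8) * x = -(x / 8) by ring, abs_of_nonneg (by positivity)]
    have h4 := Real.exp_pos (-(x / 8))
    linarith

/-! ### From the half line to the line -/

theorem scaledPotential_neg (x : ℝ) : scaledPotential (-x) = scaledPotential x := by
  simp only [scaledPotential, neg_div, Real.cosh_neg, Real.sinh_neg]
  ring

theorem scaledMode_neg (x : ℝ) : scaledMode (-x) = -scaledMode x := by
  simp only [scaledMode, neg_div, Real.cosh_neg, Real.sinh_neg]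
  ring

theorem apply_abs_of_even {f : ℝ → ℝ} (hf : ∀ x, f (-x) = f x) (x : ℝ) : f |x| = f x := by
  rcases abs_choice x with h | h <;> rw [h]
  exact hf x

theorem integral_eq_two_mul_of_even {f : ℝ → ℝ} (hf : ∀ x, f (-x) = f x) :
    ∫ x, f x = 2 * ∫ x in Ioi 0, f x := by
  rw [← integral_comp_abs]
  simp only [apply_abs_of_even hf]

theorem integrable_of_even {f : ℝ → ℝ} (hf : ∀ x, f (-x) = f x) (hi : IntegrableOn f (Ioi 0)) :
    Integrable f := by
  rw [← integrableOn_univ, ← Iic_union_Ioi (a := (0 : ℝ))]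
  refine IntegrableOn.union ?_ hi
  have h : IntegrableOn (fun x => f (-x)) (Ioi 0) := by simpa only [hf] using hi
  have := (integrableOn_Ici_iff_integrableOn_Ioi).mpr h
  have hm : MeasurableEmbedding fun x : ℝ => -x := (Homeomorph.neg ℝ).measurableEmbedding
  rw [← Measure.map_neg_eq_self (volume : Measure ℝ), hm.integrableOn_map_iff]
  simpa [Function.comp_def] using this

/-- The half-line inequality is applied to `u` and to its reflection. Both have the same primitive
because that primitive is odd, so adding the two covers the line without first proving `u` even. -/
theorem integral_potential_le {u : ℝ → ℝ} (hu : MemLp u 2 volume)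
    (ho : ∀ x, ∫ t in (0 : ℝ)..(-x), u t = -∫ t in (0 : ℝ)..x, u t)
    (h0 : ∫ x, (∫ t in (0 : ℝ)..x, u t) * scaledMode x = 0) :
    Integrable (fun x => scaledPotential x * (∫ t in (0 : ℝ)..x, u t) ^ 2) ∧
      101 / 100 * ∫ x, scaledPotential x * (∫ t in (0 : ℝ)..x, u t) ^ 2 ≤ ∫ x, u x ^ 2 := by
  set F : ℝ → ℝ := fun x => ∫ t in (0 : ℝ)..x, u t with hF
  have hv : MemLp (fun x => u (-x)) 2 volume :=
    hu.comp_measurePreserving (Measure.measurePreserving_neg volume)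
  have hFv : ∀ x, ∫ t in (0 : ℝ)..x, u (-t) = F x := by
    intro x
    rw [intervalIntegral.integral_comp_neg, neg_zero, intervalIntegral.integral_symm, ho, neg_neg]
  have heZ : ∀ x, F (-x) * scaledMode (-x) = F x * scaledMode x := by
    intro x
    rw [scaledMode_neg, hF]
    simp only [ho]
    ring
  have heP : ∀ x, scaledPotential (-x) * F (-x) ^ 2 = scaledPotential x * F x ^ 2 := by
    intro x
    rw [scaledPotential_neg, hF]
    simp only [ho]
    ring
  have h0' : ∫ x in Ioi 0, F x * scaledMode x = 0 := by
    rw [integral_eq_two_mul_of_even heZ] at h0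
    linarith
  have hPi : IntegrableOn (fun x => scaledPotential x * F x ^ 2) (Ioi 0) := by
    have h := (certificate.integrableOn_potential hu).const_mul (100 / 101)
    refine h.congr (Eventually.of_forall fun x => ?_)
    simp only [hF]
    ring
  refine ⟨integrable_of_even heP hPi, ?_⟩
  have hhalf : ∀ v : ℝ → ℝ, MemLp v 2 volume → (∀ x, ∫ t in (0 : ℝ)..x, v t = F x) →
      101 / 100 * ∫ x in Ioi 0, scaledPotential x * F x ^ 2 ≤ ∫ x in Ioi 0, v x ^ 2 := by
    intro v hv hvF
    have h := certificate.integral_nonneg hv (by simpa only [hvF] using h0')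
    simp only [hvF, mul_assoc] at h
    rw [integral_sub hv.integrable_sq.integrableOn (hPi.const_mul _), integral_const_mul] at h
    linarith
  have h1 := hhalf u hu fun _ => rfl
  have h2 := hhalf _ hv hFv
  have h3 : ∫ x in Ioi 0, u (-x) ^ 2 = ∫ x in Iic 0, u x ^ 2 := by
    simpa using integral_comp_neg_Ioi 0 fun x => u x ^ 2
  have h4 := integral_add_compl (measurableSet_Ioi (a := (0 : ℝ))) hu.integrable_sq
  rw [compl_Ioi] at h4
  rw [integral_eq_two_mul_of_even heP]
  linarith

/-! ### Undoing the scaling -/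

theorem V_mul_sqrt_two (x : ℝ) : V 8 (√2 * x) = scaledPotential x / 2 := by
  have h2 : (√2 : ℝ) ≠ 0 := by positivity
  have e1 : √2 * x / (8 * √2) = x / 8 := by field_simp
  have e2 : √2 * x / √2 = x := by field_simp
  have hc := (Real.cosh_pos (x / 8)).ne'
  have hX := (Real.cosh_pos x).ne'
  simp only [V, sech, scaledPotential, e1, e2, Real.tanh_eq_sinh_div_cosh]
  field_simp
  ring

theorem Z₁_mul_sqrt_two (x : ℝ) : Z₁ 8 (√2 * x) =
    (2 : ℝ) ^ (-(3 / 4) : ℝ) * (3 : ℝ) ^ (1 / 2 : ℝ) * scaledMode x := by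
  have h2 : (√2 : ℝ) ≠ 0 := by positivity
  have e1 : √2 * x / (8 * √2) = x / 8 := by field_simp
  have e2 : √2 * x / √2 = x := by field_simp
  simp only [Z₁, Y₁, sech, scaledMode, e1, e2, Real.tanh_eq_sinh_div_cosh, div_eq_mul_inv]
  ring

theorem integral_eq_mul_integral_comp_mul {a : ℝ} (ha : 0 < a) (f : ℝ → ℝ) :
    ∫ x, f x = a * ∫ x, f (a * x) := by
  rw [Measure.integral_comp_mul_left, abs_of_pos (inv_pos.mpr ha), smul_eq_mul,
    mul_inv_cancel_left₀ ha.ne']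

theorem memLp_comp_mul {u : ℝ → ℝ} (hu : MemLp u 2 volume) {a : ℝ} (ha : a ≠ 0) :
    MemLp (fun x => a * u (a * x)) 2 volume := by
  have hm : AEStronglyMeasurable (fun x => u (a * x)) volume :=
    hu.1.comp_quasiMeasurePreserving
      ⟨measurable_const_mul a, by
        rw [Real.map_volume_mul_left ha]
        exact Measure.smul_absolutelyContinuous⟩
  exact ((memLp_two_iff_integrable_sq hm).mpr (hu.integrable_sq.comp_mul_left' ha)).const_mul a

/-- The constant is `1 - 100/101`, since `∫ V w² ≤ (100/101) ∫ w_x²`. -/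
theorem virialForm_coercive {w w' : ℝ → ℝ} (hw' : MemLp w' 2 volume) (h : IsWeakDeriv w w')
    (ho : IsOddAE w) (h0 : ∫ x, w x * Z₁ 8 x = 0) :
    1 / 101 * ∫ x, w' x ^ 2 ≤ virialForm 8 w w' := by
  obtain ⟨hae, hodd⟩ := h.ae_eq_primitive_of_isOddAE ho
  set W : ℝ → ℝ := fun x => ∫ t in (0 : ℝ)..x, w' t with hW
  have ha : 0 < √2 := by positivity
  -- The factor `√2` in `√2 * w' (√2 * x)` makes its primitive exactly `W (√2 * x)`.
  have hu := memLp_comp_mul hw' ha.ne'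
  have hF : ∀ x, ∫ t in (0 : ℝ)..x, √2 * w' (√2 * t) = W (√2 * x) := by
    intro x
    rw [intervalIntegral.integral_const_mul, intervalIntegral.mul_integral_comp_mul_left, mul_zero]
  have hZ : ∫ x, W (√2 * x) * scaledMode x = 0 := by
    have e : ∫ x, w x * Z₁ 8 x = ∫ x, W x * Z₁ 8 x :=
      integral_congr_ae (hae.mono fun x hx => by simp only [hx, hW])
    rw [e, integral_eq_mul_integral_comp_mul ha] at h0
    simp only [Z₁_mul_sqrt_two, mul_left_comm (W _)] at h0
    rw [integral_const_mul] at h0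
    have hc : (2 : ℝ) ^ (-(3 / 4) : ℝ) * (3 : ℝ) ^ (1 / 2 : ℝ) ≠ 0 := by positivity
    exact (mul_eq_zero.mp ((mul_eq_zero.mp h0).resolve_left ha.ne')).resolve_left hc
  obtain ⟨hi, hle⟩ := integral_potential_le hu
    (fun x => by rw [hF, hF, mul_neg]; exact hodd _) (by simpa only [hF] using hZ)
  simp only [hF] at hi hle
  have hVi : Integrable fun x => V 8 x * W x ^ 2 := by
    rw [← integrable_comp_mul_left_iff _ ha.ne']
    refine (hi.div_const 2).congr (Eventually.of_forall fun x => ?_)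
    simp only [V_mul_sqrt_two]
    ring
  have hform : virialForm 8 w w' = ∫ x, w' x ^ 2 - V 8 x * W x ^ 2 :=
    integral_congr_ae (hae.mono fun x hx => by simp only [hx, hW])
  rw [hform, integral_sub hw'.integrable_sq hVi]
  have hV : ∫ x, V 8 x * W x ^ 2 = √2 * ((∫ x, scaledPotential x * W (√2 * x) ^ 2) / 2) := by
    rw [integral_eq_mul_integral_comp_mul ha, ← integral_div]
    simp only [V_mul_sqrt_two]
    congr 2
    funext x
    ring
  have hU : ∫ x, w' x ^ 2 = √2 * ((∫ x, (√2 * w' (√2 * x)) ^ 2) / 2) := by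
    rw [integral_eq_mul_integral_comp_mul ha, ← integral_div]
    simp only [mul_pow, Real.sq_sqrt (show (0 : ℝ) ≤ 2 by norm_num)]
    congr 2
    funext x
    ring
  rw [hV, hU]
  nlinarith [mul_le_mul_of_nonneg_left hle ha.le]

end KinkVirial

theorem lemma4p1 :
    (∃ κ : ℝ, 0 < κ ∧ ∀ w w' : ℝ → ℝ,
      MemLp w 2 volume → MemLp w' 2 volume → KinkVirial.IsWeakDeriv w w' →
      KinkVirial.IsOddAE w → (∫ x, w x * KinkVirial.Z₁ 8 x) = 0 →
      κ * (∫ x, w' x ^ 2) ≤ KinkVirial.virialForm 8 w w') ∧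
    (∃ κ : ℝ, 0 < κ ∧ ∀ w w' : ℝ → ℝ,
      MemLp w ⊤ volume → MemLp w' 2 volume → KinkVirial.IsWeakDeriv w w' →
      KinkVirial.IsOddAE w → (∫ x, w x * KinkVirial.Z₁ 8 x) = 0 →
      κ * (∫ x, w' x ^ 2) ≤ KinkVirial.virialForm 8 w w') :=
  have key : ∀ w w' : ℝ → ℝ, MemLp w' 2 volume → KinkVirial.IsWeakDeriv w w' →
      KinkVirial.IsOddAE w → (∫ x, w x * KinkVirial.Z₁ 8 x) = 0 →
      1 / 101 * (∫ x, w' x ^ 2) ≤ KinkVirial.virialForm 8 w w' :=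
    fun _ _ => KinkVirial.virialForm_coercive
  ⟨⟨1 / 101, by norm_num, fun w w' _ => key w w'⟩, ⟨1 / 101, by norm_num, fun w w' _ => key w w'⟩⟩
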